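/- Let $A$ be a finitely generated commutative unital real algebra, and let $\hat A$ be the set of characters of $A$ (unital algebra homomorphisms $\chi : A \to \mathbb{R}$) with the weak topology, i.e. the topology of pointwise convergence on $A$. A \emph{preorder} of a commutative unital real algebra $B$ is a subset $T \subseteq B$ with $T\cdot T \subseteq T$, $T + T \subseteq T$, $1 \in T$ and $b^2 T \subseteq T$ for all $b \in B$; it is \emph{finitely generated} if it is the smallest preorder containing some finite set. Put $K(T) = \{\chi \in \hat B : \chi(f) \ge 0 \text{ for all } f \in T\}$. A linear functional $L : B \to \mathbb{R}$ is \emph{$T$-positive} if $L(f) \ge 0$ for all $f \in T$. The preorder $T$ has the \emph{moment property (MP)} in $B$ if for each $T$-positive linear functional $L$ on $B$ there is a positive Borel measure $\mu$ on $\hat B$ such that for every $f \in B$ the function $\chi \mapsto \chi(f)$ is $\mu$-integrable and $L(f) = \int_{\hat B} \chi(f)\, d\mu(\chi)$. It has the \emph{strong moment property (SMP)} in $B$ if $\mu$ can always be chosen such that, in addition, $\operatorname{supp} \mu \subseteq K(T)$. Let $I$ be an ideal of $A$ and $T$ a finitely generated preorder of $A$. Let $\hat I$ be the ideal of all $f \in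 A$ with $\chi(f) = 0$ for all $\chi$ in the zero set $Z(I) = \{\chi \in \hat A : \chi(g) = 0 \text{ for all } g \in I\}$. The sets $T + I$ and $T + \hat I$ are preorders of $A$, and the image $(T+I)/I$ of $T+I$ under the canonical map $A \to A/I$ is a preorder of $A/I$. Then each of the following holds for (SMP), and each also holds for (MP) in place of (SMP): (i) If $T$ has (SMP) in $A$, then so does $T + I$. (ii) $T + I$ has (SMP) in $A$ if and only if $(T + I)/I$ has (SMP) in $A/I$. (iii) $T + I$ has (SMP) in $A$ if and only if $T + \hat I$ has (SMP) in $A$. -/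

import Mathlib

open MeasureTheory

namespace MomentProblem

section Characters

variable {A : Type*} [CommRing A] [Algebra ℝ A]

/-- The weak topology (topology of pointwise convergence on `A`) on the set of characters of the
real algebra `A`, that is, of unital algebra homomorphisms `A → ℝ`. -/
instance characterTopology : TopologicalSpace (A →ₐ[ℝ] ℝ) :=
  TopologicalSpace.induced (fun (χ : A →ₐ[ℝ] ℝ) (a : A) => χ a) inferInstance

/-- The Borel σ-algebra on the set of characters. -/
instance characterMeasurableSpace : MeasurableSpace (A →ₐ[ℝ] ℝ) := borel _

instance characterBorelSpace : BorelSpace (A →ₐ[ℝ] ℝ) := ⟨rfl⟩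

/-- The zero set `Z(I)` of an ideal: all characters that vanish on `I`. -/
def zeroSet (I : Ideal A) : Set (A →ₐ[ℝ] ℝ) := {χ | ∀ f ∈ I, χ f = 0}

/-- The ideal of all elements of `A` that vanish on a set `Z` of characters. -/
def vanishingIdeal (Z : Set (A →ₐ[ℝ] ℝ)) : Ideal A where
  carrier := {f | ∀ χ ∈ Z, χ f = 0}
  zero_mem' := fun χ _ => map_zero χ
  add_mem' := fun {a b} ha hb χ hχ => by rw [map_add, ha χ hχ, hb χ hχ, add_zero]
  smul_mem' := fun c {a} ha χ hχ => by rw [smul_eq_mul, map_mul, ha χ hχ, mul_zero]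

/-- The ideal `Î` of all elements of `A` that vanish on the zero set of `I`. -/
def hatIdeal (I : Ideal A) : Ideal A := vanishingIdeal (zeroSet I)

/-- `μ` represents the linear functional `L`: every `f ∈ A`, seen as the function `χ ↦ χ f` on the
characters, is `μ`-integrable, and its integral is `L f`. -/
def Represents (μ : Measure (A →ₐ[ℝ] ℝ)) (L : A →ₗ[ℝ] ℝ) : Prop :=
  ∀ f : A, Integrable (fun χ : A →ₐ[ℝ] ℝ => χ f) μ ∧ L f = ∫ χ : A →ₐ[ℝ] ℝ, χ f ∂μ

end Characters

/-- A preorder of a commutative ring `A`. It may contain `-1`, so that `RingPreordering` is not the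
right notion. -/
structure Preord (A : Type*) [CommRing A] where
  carrier : Set A
  mul_mem : ∀ a ∈ carrier, ∀ b ∈ carrier, a * b ∈ carrier
  add_mem : ∀ a ∈ carrier, ∀ b ∈ carrier, a + b ∈ carrier
  one_mem : (1 : A) ∈ carrier
  sq_mul_mem : ∀ a : A, ∀ t ∈ carrier, a ^ 2 * t ∈ carrier

namespace Preord

section Ring

variable {A : Type*} [CommRing A]

/-- `T` is finitely generated: it is the smallest preorder that contains a certain finite set. -/
def FinitelyGenerated (T : Preord A) : Prop :=
  ∃ F : Finset A, (F : Set A) ⊆ T.carrier ∧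
    ∀ S : Preord A, (F : Set A) ⊆ S.carrier → T.carrier ⊆ S.carrier

/-- The preorder `T + I = {t + i : t ∈ T, i ∈ I}`. -/
def addIdeal (T : Preord A) (I : Ideal A) : Preord A where
  carrier := {a | ∃ t ∈ T.carrier, ∃ i ∈ I, t + i = a}
  mul_mem := by
    rintro _ ⟨t, ht, i, hi, rfl⟩ _ ⟨s, hs, j, hj, rfl⟩
    refine ⟨t * s, T.mul_mem t ht s hs, t * j + i * (s + j), ?_, by ring⟩
    exact I.add_mem (I.mul_mem_left t hj) (I.mul_mem_right (s + j) hi)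
  add_mem := by
    rintro _ ⟨t, ht, i, hi, rfl⟩ _ ⟨s, hs, j, hj, rfl⟩
    exact ⟨t + s, T.add_mem t ht s hs, i + j, I.add_mem hi hj, by ring⟩
  one_mem := ⟨1, T.one_mem, 0, I.zero_mem, add_zero 1⟩
  sq_mul_mem := by
    rintro a _ ⟨t, ht, i, hi, rfl⟩
    exact ⟨a ^ 2 * t, T.sq_mul_mem a t ht, a ^ 2 * i, I.mul_mem_left (a ^ 2) hi, by ring⟩

/-- The preorder `T / I` of `A / I`: the image of `T` under the canonical map `A → A / I`. -/
def quotient (T : Preord A) (I : Ideal A) : Preord (A ⧸ I) where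
  carrier := Ideal.Quotient.mk I '' T.carrier
  mul_mem := by
    rintro _ ⟨t, ht, rfl⟩ _ ⟨s, hs, rfl⟩
    exact ⟨t * s, T.mul_mem t ht s hs, map_mul _ t s⟩
  add_mem := by
    rintro _ ⟨t, ht, rfl⟩ _ ⟨s, hs, rfl⟩
    exact ⟨t + s, T.add_mem t ht s hs, map_add _ t s⟩
  one_mem := ⟨1, T.one_mem, map_one _⟩
  sq_mul_mem := by
    rintro a _ ⟨t, ht, rfl⟩
    obtain ⟨b, rfl⟩ := Ideal.Quotient.mk_surjective a
    exact ⟨b ^ 2 * t, T.sq_mul_mem b t ht, by rw [map_mul, map_pow]⟩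

end Ring

section Algebra

variable {A : Type*} [CommRing A] [Algebra ℝ A]

/-- The set `K(T)` of characters that are nonnegative on `T`. -/
def charSet (T : Preord A) : Set (A →ₐ[ℝ] ℝ) := {χ | ∀ f ∈ T.carrier, 0 ≤ χ f}

/-- A linear functional is `T`-positive if it is nonnegative on `T`. -/
def PositiveOn (T : Preord A) (L : A →ₗ[ℝ] ℝ) : Prop := ∀ f ∈ T.carrier, 0 ≤ L f

/-- The moment property (MP). -/
def MP (T : Preord A) : Prop :=
  ∀ L : A →ₗ[ℝ] ℝ, T.PositiveOn L → ∃ μ : Measure (A →ₐ[ℝ] ℝ), Represents μ L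

/-- The strong moment property (SMP). -/
def SMP (T : Preord A) : Prop :=
  ∀ L : A →ₗ[ℝ] ℝ, T.PositiveOn L →
    ∃ μ : Measure (A →ₐ[ℝ] ℝ), μ.support ⊆ T.charSet ∧ Represents μ L

end Algebra

end Preord

end MomentProblem

/-! A functional that is nonnegative on `T + I` vanishes on `I`, because `±f` lies in `T + I` for `f
∈ I`. A representing measure therefore integrates `f ^ 2` to zero for each `f ∈ I`, so its support
lies in `Z(I)`. This gives (i), as every `T + I`-positive functional is `T`-positive. For (ii), such
a functional factors through `A ⧸ I`, and the characters of `A ⧸ I` form the closed set `Z(I)`, so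
measures are pushed forward and pulled back along this embedding. Finite generation of `A` makes the
character space second countable, so that a measure is concentrated on its support.

For (iii), `I` and `Î` have the same zero set, and the preorders `T + I` and `T + Î` have the same
positive functionals. Indeed, if `f ∈ Î`, the real Nullstellensatz gives `f ^ (2k) + s ∈ I` with `s`
a sum of squares. Both terms have nonnegative `L`-value, hence `L (f ^ (2k)) = 0`, and
Cauchy–Schwarz brings the exponent down to `L f = 0`.

Most of the work is the real Nullstellensatz (`exists_character_ne_zero`). If no `f ^ (2k) + s` is
in `I`, some real prime contains `I` but not `f`. The fraction field of its quotient is semireal and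
has a real closed extension by Zorn's lemma. By Artin–Lang (`exists_specialization`), finitely many
elements of that extension specialize to real numbers, which yields a character.

Artin–Lang is proved by adjoining one element at a time while preserving signs. A transcendental
element is replaced by an algebraic one in the same gap between the relevant roots. For algebraic
elements the trace form is used: a real place forces positive signature (`card_neg_lt_card_pos`),
the signature survives specialization, and a finite real algebra without real characters contains a
root of `-1`, multiplication by which would negate the specialized form. -/

theorem IsSumSq.map {R S : Type*} [CommRing R] [CommRing S] (f : R →+* S) {s : R}
    (hs : IsSumSq s) : IsSumSq (f s) := by
  induction hs with
  | zero => simp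
  | sq_add a _ ih => rw [map_add, map_mul]; exact IsSumSq.sq_add _ ih

theorem IsSemireal.of_ringHom {R S : Type*} [CommRing R] [CommRing S] [Nontrivial S]
    (f : R →+* S) [IsSemireal S] : IsSemireal R :=
  ⟨fun {s} hs h => IsSemireal.one_add_ne_zero (hs.map f) (by rw [← map_one f, ← map_add, h, map_zero])⟩

/-! ### Artin–Schreier: maximal semireal fields are real closed. -/

namespace RealClosure

open Polynomial

variable {K Ω : Type*} [Field K] [Field Ω] [Algebra K Ω]

/-- A relation `1 + s = 0` involves finitely many elements, so it already holds in one member of the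
chain. -/
theorem isSemireal_sSup {c : Set (IntermediateField K Ω)} (hc : IsChain (· ≤ ·) c)
    (hne : c.Nonempty) (h : ∀ E ∈ c, IsSemireal E) : IsSemireal ↥(sSup c) := by
  have hmem : ∀ x : ↥(sSup c), ∃ E ∈ c, (x : Ω) ∈ E := by
    rintro ⟨x, hx⟩
    have : Nonempty c := hne.to_subtype
    rw [sSup_eq_iSup', ← SetLike.mem_coe, IntermediateField.coe_iSup_of_directed] at hx
    · obtain ⟨E, hE⟩ := Set.mem_iUnion.1 hx
      exact ⟨E, E.2, hE⟩
    · exact hc.directed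
  have hsum : ∀ s : ↥(sSup c), IsSumSq s → ∃ E ∈ c, ∃ t : E, IsSumSq t ∧ (t : Ω) = s := by
    intro s hs
    induction hs with
    | zero => obtain ⟨E, hE⟩ := hne; exact ⟨E, hE, 0, .zero, rfl⟩
    | sq_add a _ ih =>
      obtain ⟨E, hE, t, ht, hts⟩ := ih
      obtain ⟨E', hE', ha⟩ := hmem a
      rcases hc.total hE hE' with hle | hle
      · refine ⟨E', hE', ⟨a, ha⟩ * ⟨a, ha⟩ + IntermediateField.inclusion hle t,
          .sq_add _ (ht.map (IntermediateField.inclusion hle).toRingHom), ?_⟩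
        simp [hts]
      · exact ⟨E, hE, ⟨a, hle ha⟩ * ⟨a, hle ha⟩ + t, .sq_add _ ht, by simp [hts]⟩
  refine ⟨fun {s} hs h0 => ?_⟩
  obtain ⟨E, hE, t, ht, hts⟩ := hsum s hs
  have := h E hE
  refine IsSemireal.one_add_ne_zero ht ?_
  have h1 := congrArg (Subtype.val) h0
  apply Subtype.ext
  simpa [hts] using h1

theorem exists_maximal_isSemireal [IsSemireal K] :
    ∃ E : IntermediateField K Ω, IsSemireal E ∧ ∀ M, E ≤ M → IsSemireal M → M = E := by
  have hbot : IsSemireal (⊥ : IntermediateField K Ω) :=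
    IsSemireal.of_ringHom (IntermediateField.botEquiv K Ω).toRingEquiv.toRingHom
  obtain ⟨E, -, hE⟩ := zorn_le_nonempty₀ {E : IntermediateField K Ω | IsSemireal E}
    (fun c hc hchain y hy => ⟨sSup c, isSemireal_sSup hchain ⟨y, hy⟩ hc,
      fun z hz => le_sSup hz⟩) ⊥ hbot
  exact ⟨E, hE.1, fun M hM hs => le_antisymm (hE.2 hs hM) hM⟩

/-- A semireal field has no proper semireal extension inside `Ω`. -/
def MaximalSemireal (K Ω : Type*) [Field K] [Field Ω] [Algebra K Ω] : Prop :=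
  ∀ M : IntermediateField K Ω, IsSemireal M → M = ⊥

theorem MaximalSemireal.of_maximal {E : IntermediateField K Ω}
    (hE : ∀ M, E ≤ M → IsSemireal M → M = E) : MaximalSemireal E Ω := by
  intro M hM
  have h1 : M.restrictScalars K = E := by
    refine hE _ ?_ hM
    intro x hx
    exact M.algebraMap_mem ⟨x, hx⟩
  refine le_antisymm (fun x hx => ?_) bot_le
  have : x ∈ M.restrictScalars K := hx
  rw [h1] at this
  exact IntermediateField.mem_bot.2 ⟨⟨x, this⟩, rfl⟩

theorem MaximalSemireal.exists_neg_one_isSumSq (h : MaximalSemireal K Ω) {z : Ω}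
    (hz : z ∉ (⊥ : IntermediateField K Ω)) :
    ∃ s : IntermediateField.adjoin K {z}, IsSumSq s ∧ 1 + s = 0 := by
  by_contra! hcon
  refine hz ?_
  rw [← h (IntermediateField.adjoin K {z}) ⟨fun {s} hs => hcon s hs⟩]
  exact IntermediateField.mem_adjoin_simple_self K z

/-- By maximality `-1` is a sum of squares in `K(√a)`. Comparing coefficients gives `1 + p + a * q =
0` with `p`, `q` sums of squares in `K`, so that `-a = (1 + p) / q`. -/
theorem MaximalSemireal.isSumSq_neg [IsAlgClosed Ω] [IsSemireal K] (h : MaximalSemireal K Ω) {a : K}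
    (ha : ¬ IsSquare a) : IsSumSq (-a) := by
  obtain ⟨z, hz⟩ := IsAlgClosed.exists_pow_nat_eq (algebraMap K Ω a) (n := 2) two_pos
  have hz' : z ∉ (⊥ : IntermediateField K Ω) := by
    intro hm
    obtain ⟨b, rfl⟩ := IntermediateField.mem_bot.1 hm
    refine ha ⟨b, ?_⟩
    apply FaithfulSMul.algebraMap_injective K Ω
    rw [← hz, map_mul, sq]
  have hint : IsIntegral K z := by
    refine ⟨X ^ 2 - C a, monic_X_pow_sub_C a two_ne_zero, ?_⟩
    simp [hz]
  have hlin : ∀ w ∈ IntermediateField.adjoin K {z}, ∃ x y : K,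
      w = algebraMap K Ω x + algebraMap K Ω y * z := by
    intro w hw
    rw [← IntermediateField.mem_toSubalgebra,
      IntermediateField.adjoin_simple_toSubalgebra_of_isAlgebraic hint.isAlgebraic] at hw
    induction hw using Algebra.adjoin_induction with
    | mem x hx => exact ⟨0, 1, by rw [Set.mem_singleton_iff.1 hx]; simp⟩
    | algebraMap r => exact ⟨r, 0, by simp⟩
    | add u v _ _ hu hv =>
      obtain ⟨x, y, rfl⟩ := hu
      obtain ⟨x', y', rfl⟩ := hv
      exact ⟨x + x', y + y', by simp only [map_add]; ring⟩
    | mul u v _ _ hu hv =>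
      obtain ⟨x, y, rfl⟩ := hu
      obtain ⟨x', y', rfl⟩ := hv
      refine ⟨x * x' + y * y' * a, x * y' + y * x', ?_⟩
      simp only [map_add, map_mul, ← hz]; ring
  have hsum : ∀ s : IntermediateField.adjoin K {z}, IsSumSq s → ∃ p q t : K, IsSumSq p ∧
      IsSumSq q ∧ (s : Ω) = algebraMap K Ω (p + a * q) + algebraMap K Ω t * z := by
    intro s hs
    induction hs with
    | zero => exact ⟨0, 0, 0, .zero, .zero, by simp⟩
    | sq_add w _ ih =>
      obtain ⟨p, q, t, hp, hq, hs⟩ := ih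
      obtain ⟨x, y, hw⟩ := hlin w w.2
      refine ⟨x * x + p, y * y + q, 2 * x * y + t, .sq_add _ hp, .sq_add _ hq, ?_⟩
      simp only [MulMemClass.coe_mul, AddMemClass.coe_add, hs, hw, map_add, map_mul, ← hz,
        map_ofNat]
      ring
  obtain ⟨s, hs, h0⟩ := h.exists_neg_one_isSumSq hz'
  obtain ⟨p, q, t, hp, hq, hst⟩ := hsum s hs
  have h1 : (1 : Ω) + s = 0 := by
    have := congrArg Subtype.val h0
    simpa using this
  -- Otherwise the relation could be solved for `z`, which would put `z` in `K`.
  have ht : t = 0 := by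
    by_contra ht
    refine hz' (IntermediateField.mem_bot.2 ⟨-(1 + p + a * q) / t, ?_⟩)
    have ht' : algebraMap K Ω t ≠ 0 := by simpa using ht
    rw [map_div₀, div_eq_iff ht', map_neg, ← sub_eq_zero]
    rw [hst] at h1
    simp only [map_add, map_mul, map_one] at h1 ⊢
    linear_combination -h1
  have h2 : 1 + p + a * q = 0 := by
    apply FaithfulSMul.algebraMap_injective K Ω
    rw [hst, ht] at h1
    simp only [map_add, map_mul, map_one, map_zero, zero_mul, add_zero] at h1 ⊢
    linear_combination h1
  have hq0 : q ≠ 0 := by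
    rintro rfl
    exact IsSemireal.one_add_ne_zero hp (by simpa using h2)
  have h3 : -a = (1 + p) * q * (q⁻¹ * q⁻¹) := by
    field_simp
    linear_combination -h2
  rw [h3]
  exact (((IsSumSq.one).add hp).mul hq).mul (.mul_self _)

theorem MaximalSemireal.isSquare_of_isSumSq [IsAlgClosed Ω] [IsSemireal K]
    (h : MaximalSemireal K Ω) {a : K} (ha : IsSumSq a) : IsSquare a := by
  by_contra hn
  have ha0 : a ≠ 0 := fun h0 => hn (h0 ▸ IsSquare.zero)
  have h1 : IsSumSq (-1 : K) := by
    have : (-1 : K) = a * (-a) * (a⁻¹ * a⁻¹) := by field_simp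
    rw [this]
    exact (ha.mul (h.isSumSq_neg hn)).mul (.mul_self _)
  exact IsSemireal.not_isSumSq_neg_one K h1

/-- The leading coefficients are nonzero squares, which cannot cancel in a semireal field; `hsq`
turns their sum back into a square, which keeps the induction going. -/
theorem natDegree_of_isSumSq [IsSemireal K] (hsq : ∀ a : K, IsSumSq a → IsSquare a) {n : ℕ}
    (l : List K[X]) (hl : ∀ g ∈ l, g.natDegree ≤ n) :
    (l.map fun g => g * g).sum = 0 ∨ (IsSquare (l.map fun g => g * g).sum.leadingCoeff ∧
      Even (l.map fun g => g * g).sum.natDegree ∧ (l.map fun g => g * g).sum.natDegree ≤ 2 * n) := by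
  induction l with
  | nil => left; simp
  | cons g l ih =>
    have ih := ih fun p hp => hl p (List.mem_cons_of_mem _ hp)
    rw [List.map_cons, List.sum_cons]
    set s := (l.map fun g => g * g).sum
    have hg := hl g List.mem_cons_self
    by_cases hg0 : g = 0
    · simpa [hg0] using ih
    have hgd : (g * g).natDegree = g.natDegree + g.natDegree := natDegree_mul hg0 hg0
    have hgl : (g * g).leadingCoeff = g.leadingCoeff * g.leadingCoeff := leadingCoeff_mul _ _
    have hgg : g * g ≠ 0 := mul_ne_zero hg0 hg0
    right
    rcases ih with h0 | ⟨h1, h2, h3⟩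
    · rw [h0, add_zero, hgd, hgl]
      exact ⟨⟨_, rfl⟩, ⟨_, rfl⟩, by omega⟩
    · rcases lt_trichotomy (g * g).natDegree s.natDegree with hlt | heq | hgt
      · rw [leadingCoeff_add_of_degree_lt (degree_lt_degree hlt),
          natDegree_add_eq_right_of_natDegree_lt hlt]
        exact ⟨h1, h2, h3⟩
      · by_cases hs0 : s = 0
        · rw [hs0, add_zero, hgd, hgl]
          exact ⟨⟨_, rfl⟩, ⟨_, rfl⟩, by omega⟩
        have hne : (g * g).leadingCoeff + s.leadingCoeff ≠ 0 := by
          rw [hgl]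
          obtain ⟨c, hc⟩ := h1
          rw [hc]
          have hb : g.leadingCoeff ≠ 0 := leadingCoeff_ne_zero.2 hg0
          intro h0
          refine IsSemireal.one_add_ne_zero (IsSumSq.mul_self (c / g.leadingCoeff)) ?_
          field_simp
          linear_combination h0
        have hdeg : (g * g).degree = s.degree := by
          rw [degree_eq_natDegree hgg, degree_eq_natDegree hs0, heq]
        have hnd : (g * g + s).natDegree = s.natDegree := by
          refine natDegree_eq_of_degree_eq ?_
          rw [degree_add_eq_of_leadingCoeff_add_ne_zero hne, hdeg, max_self]
        rw [leadingCoeff_add_of_degree_eq hdeg hne, hnd]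
        refine ⟨hsq _ ?_, h2, h3⟩
        rw [hgl]
        exact .sq_add _ h1.isSumSq
      · rw [leadingCoeff_add_of_degree_lt' (degree_lt_degree hgt),
          natDegree_add_eq_left_of_natDegree_lt hgt, hgd, hgl]
        exact ⟨⟨_, rfl⟩, ⟨_, rfl⟩, by omega⟩

theorem _root_.IsSumSq.exists_list {R : Type*} [CommRing R] {s : R} (hs : IsSumSq s) :
    ∃ l : List R, s = (l.map fun g => g * g).sum := by
  induction hs with
  | zero => exact ⟨[], rfl⟩
  | sq_add a _ ih => obtain ⟨l, rfl⟩ := ih; exact ⟨a :: l, by simp⟩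

theorem isSumSq_list_sum {R : Type*} [CommRing R] (l : List R) :
    IsSumSq (l.map fun g => g * g).sum := by
  induction l with
  | nil => simp
  | cons a l ih => rw [List.map_cons, List.sum_cons]; exact .sq_add _ ih

/-- For irreducible `f` without a root in `K`, maximality gives `f * q = 1 + ∑ g ^ 2` with every `g`
of degree below `n`. The right side has even degree at most `2n - 2`, so `q` has odd degree below
`n` and, by induction, a root. There `1 + ∑ g ^ 2` vanishes, against semireality. -/
theorem MaximalSemireal.exists_isRoot [IsAlgClosed Ω] [IsSemireal K] (h : MaximalSemireal K Ω)
    (n : ℕ) : ∀ f : K[X], f.natDegree = n → Odd n → ∃ x, f.IsRoot x := by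
  induction n using Nat.strong_induction_on with
  | _ n ih =>
  intro f hf hodd
  have hn : 0 < n := hodd.pos
  have hf0 : f ≠ 0 := by rintro rfl; simp at hf; omega
  by_cases hirr : Irreducible f
  · obtain ⟨z, hz⟩ := IsAlgClosed.exists_aeval_eq_zero Ω f (by
      rw [degree_eq_natDegree hf0, hf]; exact_mod_cast hn.ne')
    have hint : IsIntegral K z := by
      rw [← isAlgebraic_iff_isIntegral]; exact ⟨f, hf0, hz⟩
    by_cases hzb : z ∈ (⊥ : IntermediateField K Ω)
    · obtain ⟨b, rfl⟩ := IntermediateField.mem_bot.1 hzb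
      refine ⟨b, ?_⟩
      apply FaithfulSMul.algebraMap_injective K Ω
      rw [map_zero, ← hz, aeval_algebraMap_apply]; simp
    exfalso
    have hdvd : ∀ g : K[X], aeval z g = 0 → f ∣ g := by
      intro g hg
      have h1 := minpoly.dvd K z hz
      have h2 := minpoly.dvd K z hg
      exact ((minpoly.irreducible hint).associated_of_dvd hirr h1).symm.dvd.trans h2
    have hmem : ∀ w ∈ IntermediateField.adjoin K {z}, ∃ g : K[X], g.natDegree ≤ n - 1 ∧
        w = aeval z g := by
      intro w hw
      rw [← IntermediateField.mem_toSubalgebra,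
        IntermediateField.adjoin_simple_toSubalgebra_of_isAlgebraic hint.isAlgebraic,
        Algebra.adjoin_singleton_eq_range_aeval] at hw
      obtain ⟨g, rfl⟩ := hw
      refine ⟨g % f, ?_, ?_⟩
      · have := natDegree_mod_lt g (q := f) (by omega)
        omega
      · change aeval z g = _
        conv_lhs => rw [← EuclideanDomain.div_add_mod g f, map_add, map_mul, hz]
        simp
    obtain ⟨s, hs, h0⟩ := h.exists_neg_one_isSumSq hzb
    obtain ⟨l, rfl⟩ := hs.exists_list
    have hl : ∀ l : List (IntermediateField.adjoin K {z}), ∃ m : List K[X],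
        (∀ g ∈ m, g.natDegree ≤ n - 1) ∧
        (((l.map fun g => g * g).sum : IntermediateField.adjoin K {z}) : Ω) =
          aeval z (m.map fun g => g * g).sum := by
      intro l
      induction l with
      | nil => exact ⟨[], by simp, by simp⟩
      | cons a l ih =>
        obtain ⟨m, hm, hml⟩ := ih
        obtain ⟨g, hg, hga⟩ := hmem a a.2
        refine ⟨g :: m, by simpa [hg] using hm, ?_⟩
        rw [List.map_cons, List.sum_cons, List.map_cons, List.sum_cons, map_add, map_mul, ← hga,
          ← hml]
        rfl
    obtain ⟨m, hm, hml⟩ := hl l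
    have h1 : aeval z (((1 : K[X]) :: m).map fun g => g * g).sum = 0 := by
      rw [List.map_cons, List.sum_cons, map_add, ← hml]
      have := congrArg Subtype.val h0
      simpa using this
    have hone : IsSumSq (m.map fun g => g * g).sum := isSumSq_list_sum m
    obtain ⟨q, hq⟩ := hdvd _ h1
    have hev : ∀ x : K, ((((1 : K[X]) :: m).map fun g => g * g).sum).eval x ≠ 0 := by
      intro x hx
      rw [List.map_cons, List.sum_cons, eval_add] at hx
      refine IsSemireal.one_add_ne_zero (hone.map (evalRingHom x)) ?_
      simpa using hx
    rcases natDegree_of_isSumSq (fun a => h.isSquare_of_isSumSq) (n := n - 1) ((1 : K[X]) :: m)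
        (by simpa using hm) with h2 | ⟨-, h3, h4⟩
    · exact hev 0 (by rw [h2, eval_zero])
    · have hq0 : q ≠ 0 := by
        rintro rfl
        exact hev 0 (by rw [hq, mul_zero, eval_zero])
      rw [hq, natDegree_mul hf0 hq0, hf] at h3 h4
      obtain ⟨x, hx⟩ := ih q.natDegree (by omega) q rfl (by
        rcases Nat.even_or_odd q.natDegree with he | ho
        · exact absurd (hodd.add_even he) (Nat.not_odd_iff_even.2 h3)
        · exact ho)
      refine hev x ?_
      rw [hq, eval_mul, hx.eq_zero, mul_zero]
  · have hnu : ¬ IsUnit f := fun hu => by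
      rw [natDegree_eq_zero_of_isUnit hu] at hf; omega
    rw [irreducible_iff] at hirr
    push Not at hirr
    obtain ⟨p, q, hpq, hp, hq⟩ := hirr hnu
    have hp0 : p ≠ 0 := by rintro rfl; simp [hpq] at hf0
    have hq0 : q ≠ 0 := by rintro rfl; simp [hpq] at hf0
    have hpd : 0 < p.natDegree := natDegree_pos_iff_degree_pos.2 (degree_pos_of_ne_zero_of_nonunit hp0 hp)
    have hqd : 0 < q.natDegree := natDegree_pos_iff_degree_pos.2 (degree_pos_of_ne_zero_of_nonunit hq0 hq)
    have hsum : p.natDegree + q.natDegree = n := by rw [← natDegree_mul hp0 hq0, ← hpq, hf]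
    rcases Nat.even_or_odd p.natDegree with he | ho
    · have ho : Odd q.natDegree := by
        rcases Nat.even_or_odd q.natDegree with he' | ho
        · exact absurd hodd (Nat.not_odd_iff_even.2 (hsum ▸ he.add he'))
        · exact ho
      obtain ⟨x, hx⟩ := ih q.natDegree (by omega) q rfl ho
      exact ⟨x, by rw [hpq, IsRoot.def, eval_mul, hx.eq_zero, mul_zero]⟩
    · obtain ⟨x, hx⟩ := ih p.natDegree (by omega) p rfl ho
      exact ⟨x, by rw [hpq, IsRoot.def, eval_mul, hx.eq_zero, zero_mul]⟩

theorem MaximalSemireal.isRealClosed [IsAlgClosed Ω] [IsSemireal K] (h : MaximalSemireal K Ω) :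
    IsRealClosed K where
  isSquare_or_isSquare_neg x := by
    by_cases hx : IsSquare x
    · exact .inl hx
    · exact .inr (h.isSquare_of_isSumSq (h.isSumSq_neg hx))
  exists_isRoot_of_odd_natDegree {f} hf := h.exists_isRoot _ f rfl hf

/-- The order of a real closed field, in which the nonnegative elements are the squares. -/
theorem exists_linearOrder (K : Type*) [Field K] [IsRealClosed K]
    (hsum : ∀ a b : K, IsSquare a → IsSquare b → IsSquare (a + b)) :
    ∃ _ : LinearOrder K, IsStrictOrderedRing K := by
  classical
  have hcone : ∀ a : K, IsSquare a → IsSquare (-a) → a = 0 := by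
    intro a ha hb
    by_contra h0
    refine IsSemireal.not_isSumSq_neg_one K ?_
    have : (-1 : K) = a * (-a) * (a⁻¹ * a⁻¹) := by field_simp
    rw [this]
    exact (ha.isSumSq.mul hb.isSumSq).mul (.mul_self _)
  let C : RingCone K :=
    { carrier := {a | IsSquare a}
      mul_mem' := fun {a b} ha hb => ha.mul hb
      one_mem' := IsSquare.one
      add_mem' := fun {a b} ha hb => hsum a b ha hb
      zero_mem' := IsSquare.zero
      eq_zero_of_mem_of_neg_mem' := fun {a} ha hb => hcone a ha hb }
  have : HasMemOrNegMem C := ⟨fun a => IsRealClosed.isSquare_or_isSquare_neg a⟩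
  let _ : LinearOrder K := LinearOrder.mkOfAddGroupCone C
  have : IsOrderedRing K := IsOrderedRing.mkOfCone C
  exact ⟨inferInstance, IsOrderedRing.toIsStrictOrderedRing K⟩

/-- A maximal semireal subfield of the algebraic closure; its sums of squares are squares, so the
squares are the positive cone of an order. -/
theorem exists_realClosed_extension (K : Type*) [Field K] [IsSemireal K] :
    ∃ E : IntermediateField K (AlgebraicClosure K), IsRealClosed E ∧
      ∃ _ : LinearOrder E, IsStrictOrderedRing E := by
  obtain ⟨E, hE, hmax⟩ := exists_maximal_isSemireal (K := K) (Ω := AlgebraicClosure K)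
  have h := MaximalSemireal.of_maximal hmax
  have hrc : IsRealClosed E := h.isRealClosed
  exact ⟨E, hrc, exists_linearOrder E fun a b ha hb =>
    h.isSquare_of_isSumSq (ha.isSumSq.add hb.isSumSq)⟩

end RealClosure

/-! ### Adjoining `i` to a real closed field gives an algebraically closed field. -/

namespace RealClosure

open Polynomial

theorem exists_sq_eq_of_finrank_eq_two {F E : Type*} [Field F] [Field E] [Algebra F E]
    [CharZero F] (h : Module.finrank F E = 2) :
    ∃ (w : E) (d : F), w ^ 2 = algebraMap F E d ∧ w ∉ Set.range (algebraMap F E) := by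
  have : FiniteDimensional F E := Module.finite_of_finrank_eq_succ h
  obtain ⟨z, hz⟩ : ∃ z : E, z ∉ (⊥ : Subalgebra F E) := by
    by_contra! hcon
    have : (⊥ : Subalgebra F E) = ⊤ := eq_top_iff.2 fun x _ => hcon x
    rw [Subalgebra.bot_eq_top_iff_finrank_eq_one, h] at this
    omega
  have hint : IsIntegral F z := Algebra.IsIntegral.isIntegral z
  have hdeg : (minpoly F z).natDegree = 2 := by
    have h1 : (minpoly F z).natDegree ≤ 2 := h ▸ minpoly.natDegree_le z
    have h2 : 2 ≤ (minpoly F z).natDegree := by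
      rw [minpoly.two_le_natDegree_iff hint]
      exact fun hr => hz (Algebra.mem_bot.2 hr)
    omega
  have hm := minpoly.monic hint
  have ha := minpoly.aeval F z
  rw [aeval_eq_sum_range, hdeg] at ha
  simp only [Finset.sum_range_succ, Finset.range_zero, Finset.sum_empty, zero_add, pow_zero,
    pow_one] at ha
  have hc : (minpoly F z).coeff 2 = 1 := by rw [← hdeg]; exact hm.coeff_natDegree
  rw [hc, one_smul, Algebra.smul_def, Algebra.smul_def, mul_one] at ha
  set u := (minpoly F z).coeff 1
  set v := (minpoly F z).coeff 0
  -- Completing the square in `z ^ 2 + u * z + v = 0`.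
  refine ⟨2 * z + algebraMap F E u, u ^ 2 - 4 * v, ?_, ?_⟩
  · simp only [map_sub, map_mul, map_pow, map_ofNat]
    linear_combination 4 * ha
  · rintro ⟨b, hb⟩
    refine hz (Algebra.mem_bot.2 ⟨(b - u) / 2, ?_⟩)
    have : CharZero E := charZero_of_injective_algebraMap (algebraMap F E).injective
    rw [map_div₀, map_sub, hb, map_ofNat]
    field_simp
    ring

variable {K : Type*} [Field K] [IsRealClosed K]

theorem finrank_eq_one_of_odd {E : Type*} [Field E] [Algebra K E] [FiniteDimensional K E]
    (h : Odd (Module.finrank K E)) : Module.finrank K E = 1 := by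
  have : CharZero K := inferInstance
  obtain ⟨θ, hθ⟩ := Field.exists_primitive_element K E
  have hint : IsIntegral K θ := Algebra.IsIntegral.isIntegral θ
  have hd : (minpoly K θ).natDegree = Module.finrank K E := by
    rw [← IntermediateField.adjoin.finrank hint, hθ, IntermediateField.finrank_top']
  obtain ⟨x, hx⟩ := IsRealClosed.exists_isRoot_of_odd_natDegree (f := minpoly K θ) (by rwa [hd])
  rw [← hd]
  exact natDegree_eq_of_degree_eq_some
    (degree_eq_one_of_irreducible_of_root (minpoly.irreducible hint) hx)

/-- The fixed field of a Sylow 2-subgroup has odd degree over `K`, hence equals `K`. -/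
theorem card_gal_eq_two_pow (E : Type*) [Field E] [Algebra K E] [FiniteDimensional K E]
    [IsGalois K E] : ∃ n, Nat.card (E ≃ₐ[K] E) = 2 ^ n := by
  obtain ⟨P⟩ := (inferInstance : Nonempty (Sylow 2 (E ≃ₐ[K] E)))
  have hidx : Module.finrank K (IntermediateField.fixedField (P : Subgroup (E ≃ₐ[K] E))) =
      (P : Subgroup (E ≃ₐ[K] E)).index := by
    have h1 := IntermediateField.finrank_fixedField_eq_card (P : Subgroup (E ≃ₐ[K] E))
    have h2 := Module.finrank_mul_finrank K
      (IntermediateField.fixedField (P : Subgroup (E ≃ₐ[K] E))) E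
    have h3 := Subgroup.card_mul_index (P : Subgroup (E ≃ₐ[K] E))
    rw [IsGalois.card_aut_eq_finrank, ← h2, h1, mul_comm] at h3
    exact (Nat.eq_of_mul_eq_mul_right Nat.card_pos h3).symm
  have hodd : Odd (P : Subgroup (E ≃ₐ[K] E)).index := by
    rw [← Nat.not_even_iff_odd, even_iff_two_dvd]
    exact P.not_dvd_index
  rw [← hidx] at hodd
  have h1 := finrank_eq_one_of_odd hodd
  rw [hidx, Subgroup.index_eq_one] at h1
  obtain ⟨n, hn⟩ := P.isPGroup'.exists_card_eq
  refine ⟨n, ?_⟩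
  rw [← hn, h1, Subgroup.card_top]

variable [LinearOrder K] [IsStrictOrderedRing K]

theorem exists_sq_eq_add_mul_I {E : Type*} [Field E] [Algebra K E] {i : E} (hi : i ^ 2 = -1)
    (a b : K) : ∃ x y : K,
    (algebraMap K E x + algebraMap K E y * i) ^ 2 = algebraMap K E a + algebraMap K E b * i := by
  have hr : ∀ t : K, 0 ≤ t → ∃ s, 0 ≤ s ∧ s ^ 2 = t := by
    intro t ht
    obtain ⟨s, hs⟩ := IsRealClosed.exists_eq_pow_of_nonneg ht two_ne_zero
    exact ⟨|s|, abs_nonneg s, by rw [sq_abs, hs]⟩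
  obtain ⟨r, hr0, hrs⟩ := hr (a ^ 2 + b ^ 2) (by positivity)
  have hra : |a| ≤ r := abs_le_of_sq_le_sq (by rw [hrs]; nlinarith [sq_nonneg b]) hr0
  obtain ⟨h1, h2⟩ := abs_le.1 hra
  -- With `r` the modulus of `a + b * i`, the usual half-angle formulas; only the sign of `y`
  -- remains to be chosen.
  obtain ⟨x, hx0, hx⟩ := hr ((r + a) / 2) (by linarith)
  obtain ⟨y, hy0, hy⟩ := hr ((r - a) / 2) (by linarith)
  have hxy : (2 * x * y) ^ 2 = b ^ 2 := by
    calc (2 * x * y) ^ 2 = 4 * x ^ 2 * y ^ 2 := by ring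
      _ = b ^ 2 := by rw [hx, hy]; linear_combination hrs
  have hre : x ^ 2 - y ^ 2 = a := by rw [hx, hy]; ring
  have key : ∀ y' : K, y' ^ 2 = y ^ 2 → 2 * x * y' = b →
      (algebraMap K E x + algebraMap K E y' * i) ^ 2 =
        algebraMap K E a + algebraMap K E b * i := by
    intro y' h1 h2
    rw [← hre, ← h2, ← h1]
    simp only [map_sub, map_mul, map_pow, map_ofNat]
    linear_combination (algebraMap K E y') ^ 2 * hi
  rcases sq_eq_sq_iff_eq_or_eq_neg.1 hxy with h | h
  · exact ⟨x, y, key y rfl h⟩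
  · exact ⟨x, -y, key (-y) (by ring) (by linear_combination -h)⟩

/-- The Galois group over `K(i)` is a 2-group. If it were nontrivial, a subgroup of index 2 would
yield a quadratic extension of `K(i)`, where every element is already a square. -/
theorem exists_eq_add_mul_I_of_isGalois {E : Type*} [Field E] [Algebra K E] [FiniteDimensional K E]
    [IsGalois K E] {i : E} (hi : i ^ 2 = -1) (z : E) :
    ∃ a b : K, z = algebraMap K E a + algebraMap K E b * i := by
  have hint : IsIntegral K i := Algebra.IsIntegral.isIntegral i
  have hmem : ∀ w ∈ IntermediateField.adjoin K {i}, ∃ a b : K,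
      w = algebraMap K E a + algebraMap K E b * i := by
    intro w hw
    rw [← IntermediateField.mem_toSubalgebra,
      IntermediateField.adjoin_simple_toSubalgebra_of_isAlgebraic hint.isAlgebraic] at hw
    induction hw using Algebra.adjoin_induction with
    | mem x hx => exact ⟨0, 1, by rw [Set.mem_singleton_iff.1 hx]; simp⟩
    | algebraMap r => exact ⟨r, 0, by simp⟩
    | add u v _ _ hu hv =>
      obtain ⟨x, y, rfl⟩ := hu
      obtain ⟨x', y', rfl⟩ := hv
      exact ⟨x + x', y + y', by simp only [map_add]; ring⟩
    | mul u v _ _ hu hv =>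
      obtain ⟨x, y, rfl⟩ := hu
      obtain ⟨x', y', rfl⟩ := hv
      refine ⟨x * x' - y * y', x * y' + y * x', ?_⟩
      simp only [map_add, map_mul, map_sub]
      linear_combination (algebraMap K E y * algebraMap K E y') * hi
  set F := IntermediateField.adjoin K {i} with hF
  have hiF : i ∈ F := IntermediateField.mem_adjoin_simple_self K i
  have hcard : Nat.card (E ≃ₐ[F] E) = 1 := by
    obtain ⟨n, hn⟩ := card_gal_eq_two_pow (K := K) E
    have hdvd : Nat.card (E ≃ₐ[F] E) ∣ 2 ^ n := by
      rw [← hn, IsGalois.card_aut_eq_finrank, IsGalois.card_aut_eq_finrank]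
      exact ⟨_, ((mul_comm _ _).trans (Module.finrank_mul_finrank K F E)).symm⟩
    obtain ⟨m, -, hm⟩ := (Nat.dvd_prime_pow Nat.prime_two).1 hdvd
    rcases m with _ | m
    · simpa using hm
    exfalso
    obtain ⟨H, hH⟩ := Sylow.exists_subgroup_card_pow_prime (G := E ≃ₐ[F] E) 2 (n := m)
      (by rw [hm]; exact pow_dvd_pow 2 (Nat.le_succ m))
    have h1 : Module.finrank F (IntermediateField.fixedField H) = 2 := by
      have h1 := IntermediateField.finrank_fixedField_eq_card H
      have h2 := Module.finrank_mul_finrank F (IntermediateField.fixedField H) E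
      rw [h1, ← IsGalois.card_aut_eq_finrank F E, hm, hH, pow_succ, mul_comm] at h2
      exact Nat.eq_of_mul_eq_mul_left (by positivity) h2
    obtain ⟨w, d, hwd, hw⟩ := exists_sq_eq_of_finrank_eq_two h1
    obtain ⟨a, b, hab⟩ := hmem d d.2
    obtain ⟨x, y, hxy⟩ := exists_sq_eq_add_mul_I (E := F) (i := ⟨i, hiF⟩)
      (Subtype.ext (by simpa using hi)) a b
    have hd : d = (algebraMap K F x + algebraMap K F y * ⟨i, hiF⟩) ^ 2 := by
      rw [hxy]
      exact Subtype.ext (by rw [hab]; rfl)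
    rw [hd, map_pow] at hwd
    rcases sq_eq_sq_iff_eq_or_eq_neg.1 hwd with h | h
    · exact hw ⟨_, h.symm⟩
    · exact hw ⟨-_, by rw [h, map_neg]⟩
  have hfr : Module.finrank F E = 1 := by rw [← IsGalois.card_aut_eq_finrank, hcard]
  have htop := Subalgebra.bot_eq_top_iff_finrank_eq_one.2 hfr
  have hz : z ∈ (⊥ : Subalgebra F E) := htop ▸ Algebra.mem_top
  obtain ⟨w, rfl⟩ := Algebra.mem_bot.1 hz
  exact hmem w w.2

variable {Ω : Type*} [Field Ω] [Algebra K Ω] [Algebra.IsAlgebraic K Ω] [IsAlgClosed Ω]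

theorem exists_eq_add_mul_I {i : Ω} (hi : i ^ 2 = -1) (z : Ω) :
    ∃ a b : K, z = algebraMap K Ω a + algebraMap K Ω b * i := by
  have halg : IsAlgClosure K Ω := ⟨inferInstance, inferInstance⟩
  have hn : Normal K Ω := IsAlgClosure.normal K Ω
  let E₀ := IntermediateField.adjoin K ({i, z} : Set Ω)
  have : FiniteDimensional K E₀ := IntermediateField.finiteDimensional_adjoin
    fun x _ => Algebra.IsIntegral.isIntegral x
  let E := IntermediateField.normalClosure K E₀ Ω
  have hle : E₀ ≤ E := IntermediateField.le_normalClosure E₀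
  have hsub : ({i, z} : Set Ω) ⊆ E₀ := IntermediateField.subset_adjoin K _
  have : Normal K E := normalClosure.normal K E₀ Ω
  have : IsGalois K E := ⟨⟩
  have hiE : i ∈ E := hle (hsub (by simp))
  have hzE : z ∈ E := hle (hsub (by simp))
  obtain ⟨a, b, hab⟩ := exists_eq_add_mul_I_of_isGalois (K := K) (E := E) (i := ⟨i, hiE⟩)
    (Subtype.ext (by simpa using hi)) ⟨z, hzE⟩
  exact ⟨a, b, congrArg Subtype.val hab⟩

/-- Complex conjugation over a real closed field. -/
theorem exists_conj (K Ω : Type*) [Field K] [IsRealClosed K] [LinearOrder K]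
    [IsStrictOrderedRing K] [Field Ω] [Algebra K Ω] [Algebra.IsAlgebraic K Ω] [IsAlgClosed Ω] :
    ∃ c : Ω ≃ₐ[K] Ω, (∀ z, c (c z) = z) ∧ (∀ z, c z = z → z ∈ Set.range (algebraMap K Ω)) ∧
      ∃ i : Ω, ∀ z, ∃ a b : K, z = algebraMap K Ω a + algebraMap K Ω b * i := by
  have halg : IsAlgClosure K Ω := ⟨inferInstance, inferInstance⟩
  have hn : Normal K Ω := IsAlgClosure.normal K Ω
  have hgal : IsGalois K Ω := ⟨⟩
  obtain ⟨i, hi⟩ := IsAlgClosed.exists_pow_nat_eq (-1 : Ω) (n := 2) two_pos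
  have hir : i ∉ (⊥ : IntermediateField K Ω) := by
    intro hm
    obtain ⟨b, rfl⟩ := IntermediateField.mem_bot.1 hm
    have : b ^ 2 = -1 := (algebraMap K Ω).injective (by simpa using hi)
    nlinarith [sq_nonneg b]
  obtain ⟨c, hc⟩ : ∃ c : Ω ≃ₐ[K] Ω, c i ≠ i := by
    by_contra! hcon
    exact hir ((InfiniteGalois.mem_bot_iff_fixed i).2 hcon)
  have hci : c i = -i := by
    have h1 : (c i) ^ 2 = i ^ 2 := by rw [← map_pow, hi, map_neg, map_one]
    exact (sq_eq_sq_iff_eq_or_eq_neg.1 h1).resolve_left hc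
  have hform : ∀ a b : K, c (algebraMap K Ω a + algebraMap K Ω b * i) =
      algebraMap K Ω a - algebraMap K Ω b * i := by
    intro a b
    rw [map_add, map_mul, hci, AlgEquiv.commutes, AlgEquiv.commutes]; ring
  refine ⟨c, fun z => ?_, fun z hz => ?_, i, exists_eq_add_mul_I hi⟩
  · obtain ⟨a, b, rfl⟩ := exists_eq_add_mul_I (K := K) hi z
    rw [hform, map_sub, map_mul, hci, AlgEquiv.commutes, AlgEquiv.commutes]; ring
  · obtain ⟨a, b, rfl⟩ := exists_eq_add_mul_I (K := K) hi z
    rw [hform] at hz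
    have hi0 : i ≠ 0 := by rintro rfl; simp at hi
    have : CharZero Ω := charZero_of_injective_algebraMap (algebraMap K Ω).injective
    have h2 : (2 * algebraMap K Ω b) * i = 0 := by linear_combination -hz
    have hb : algebraMap K Ω b = 0 := by simpa [hi0] using h2
    exact ⟨a, by rw [hb]; ring⟩

end RealClosure

/-! ### Sign changes of polynomials over a real closed field. -/

namespace RealClosure

open Polynomial

section Sign

variable {K : Type*} [Field K] [IsRealClosed K] [LinearOrder K] [IsStrictOrderedRing K]

/-- An irreducible polynomial is either linear or a constant multiple of `(X - u) ^ 2 + v ^ 2`, and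
the latter has constant sign. -/
theorem eval_mul_eval_pos_of_irreducible {f : K[X]} (hf : Irreducible f) {a b : K}
    (h : ∀ x ∈ Set.Icc a b, f.eval x ≠ 0) (hab : a ≤ b) : 0 < f.eval a * f.eval b := by
  by_cases hr : ∃ x, f.IsRoot x
  · obtain ⟨x, hx⟩ := hr
    have hd := degree_eq_one_of_irreducible_of_root hf hx
    have hx' : x < a ∨ b < x := by
      by_contra! hcon
      exact h x hcon hx
    have hform := eq_X_add_C_of_degree_le_one hd.le
    have h1 : f.coeff 1 ≠ 0 := by
      intro h0
      rw [h0, map_zero, zero_mul, zero_add] at hform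
      rw [hform] at hd
      have := hd ▸ degree_C_le (a := f.coeff 0)
      norm_num at this
    have hev : ∀ y, f.eval y = f.coeff 1 * (y - x) := by
      intro y
      have h2 : f.coeff 1 * x + f.coeff 0 = 0 := by
        have := hx.eq_zero
        rw [hform] at this
        simpa using this
      rw [hform]
      simp only [eval_add, eval_mul, eval_C, eval_X, coeff_add, coeff_C_mul, coeff_X_one,
        coeff_C_succ, mul_one, add_zero]
      linear_combination h2
    rw [hev, hev]
    have h3 : 0 < f.coeff 1 * f.coeff 1 := mul_self_pos.2 h1
    have h4 : 0 < (a - x) * (b - x) := by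
      rcases hx' with hx' | hx'
      · exact mul_pos (by linarith) (by linarith)
      · exact mul_pos_of_neg_of_neg (by linarith) (by linarith)
    calc 0 < (f.coeff 1 * f.coeff 1) * ((a - x) * (b - x)) := mul_pos h3 h4
      _ = _ := by ring
  · have hdeg : 2 ≤ f.natDegree := by
      have h0 := hf.natDegree_pos
      have h1 : f.natDegree ≠ 1 := by
        intro h1
        exact hr (exists_root_of_degree_eq_one ((degree_eq_iff_natDegree_eq_of_pos one_pos).2 h1))
      omega
    obtain ⟨i, hi⟩ := IsAlgClosed.exists_pow_nat_eq (-1 : AlgebraicClosure K) (n := 2) two_pos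
    obtain ⟨z, hz⟩ := IsAlgClosed.exists_aeval_eq_zero (AlgebraicClosure K) f hf.degree_pos.ne'
    obtain ⟨u, v, huv⟩ := exists_eq_add_mul_I (K := K) hi z
    let q : K[X] := (X - C u) ^ 2 + C (v ^ 2)
    have hqz : aeval z q = 0 := by
      simp only [q, huv, map_add, map_sub, map_pow, aeval_X, aeval_C]
      linear_combination (algebraMap K (AlgebraicClosure K) v) ^ 2 * hi
    have hqd : q.natDegree = 2 := by
      have : q.natDegree = ((X - C u) ^ 2 : K[X]).natDegree := natDegree_add_C
      rw [this, natDegree_pow, natDegree_X_sub_C]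
    have hq0 : q ≠ 0 := by intro h0; rw [h0] at hqd; simp at hqd
    have hint : IsIntegral K z := Algebra.IsIntegral.isIntegral z
    obtain ⟨g, hg⟩ : f ∣ q :=
      ((minpoly.irreducible hint).associated_of_dvd hf (minpoly.dvd K z hz)).symm.dvd.trans
        (minpoly.dvd K z hqz)
    have hg0 : g ≠ 0 := by rintro rfl; exact hq0 (by rw [hg, mul_zero])
    have hgd : g.natDegree = 0 := by
      rw [hg, natDegree_mul hf.ne_zero hg0] at hqd
      omega
    obtain ⟨c, rfl⟩ := natDegree_eq_zero.1 hgd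
    have hc : c ≠ 0 := by rintro rfl; simp at hg0
    have hev : ∀ y, f.eval y * c = (y - u) ^ 2 + v ^ 2 := by
      intro y
      have := congrArg (eval y) hg
      simpa [q] using this.symm
    have hpos : ∀ y, 0 < f.eval y * c := by
      intro y
      refine lt_of_le_of_ne (by rw [hev]; positivity) fun h0 => hr ⟨y, ?_⟩
      exact (mul_eq_zero.1 h0.symm).resolve_right hc
    have h1 := mul_pos (hpos a) (hpos b)
    have h2 : 0 < c * c := mul_self_pos.2 hc
    refine (mul_pos_iff_of_pos_right h2).1 ?_
    calc _ < _ := h1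
      _ = _ := by ring

theorem eval_mul_eval_pos {p : K[X]} {a b : K} (hab : a ≤ b)
    (h : ∀ x ∈ Set.Icc a b, p.eval x ≠ 0) : 0 < p.eval a * p.eval b := by
  induction p using WfDvdMonoid.induction_on_irreducible with
  | zero => exact absurd (eval_zero) (h a ⟨le_rfl, hab⟩)
  | unit u hu =>
    obtain ⟨c, hc, rfl⟩ := Polynomial.isUnit_iff.1 hu
    simpa using mul_self_pos.2 hc.ne_zero
  | mul q i hq hi ih =>
    have h1 := ih fun x hx h0 => h x hx (by rw [eval_mul, h0, mul_zero])
    have h2 := eval_mul_eval_pos_of_irreducible hi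
      (fun x hx h0 => h x hx (by rw [eval_mul, h0, zero_mul])) hab
    rw [eval_mul, eval_mul]
    calc 0 < _ := mul_pos h2 h1
      _ = _ := by ring

end Sign

/-! ### Quadratic forms and finite real algebras without real characters. -/

section Signature

/-- If `x` is supported on the positive coordinates and the negative coordinates of `J x` vanish,
the form is nonnegative at both. Since `J` negates the form, it is zero at `x`, so `x = 0`. Thus the
positive subspace injects into the negative one. -/
theorem card_pos_le_card_neg {ι : Type*} [Fintype ι] {D : ι → ℝ} (hD : ∀ i, D i ≠ 0)
    (J : (ι → ℝ) →ₗ[ℝ] (ι → ℝ)) (hJ : ∀ x, ∑ i, D i * J x i ^ 2 = -∑ i, D i * x i ^ 2) :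
    Fintype.card {i // 0 < D i} ≤ Fintype.card {i // D i < 0} := by
  classical
  let ext : ({i // 0 < D i} → ℝ) →ₗ[ℝ] (ι → ℝ) :=
    { toFun := fun y i => if h : 0 < D i then y ⟨i, h⟩ else 0
      map_add' := fun y z => by ext i; by_cases h : 0 < D i <;> simp [h]
      map_smul' := fun r y => by ext i; by_cases h : 0 < D i <;> simp [h] }
  let Φ : ({i // 0 < D i} → ℝ) →ₗ[ℝ] ({i // D i < 0} → ℝ) :=
    (LinearMap.funLeft ℝ ℝ Subtype.val) ∘ₗ J ∘ₗ ext
  have hinj : Function.Injective Φ := by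
    rw [injective_iff_map_eq_zero]
    intro y hy
    have h1 : ∀ i, 0 ≤ D i * J (ext y) i ^ 2 := by
      intro i
      rcases lt_or_gt_of_ne (hD i) with h | h
      · have : J (ext y) i = 0 := congrFun hy ⟨i, h⟩
        simp [this]
      · positivity
    have h2 : ∀ i, 0 ≤ D i * ext y i ^ 2 := by
      intro i
      by_cases h : 0 < D i
      · positivity
      · simp [ext, h]
    have h3 : ∑ i, D i * ext y i ^ 2 = 0 := by
      have := hJ (ext y)
      have h4 := Finset.sum_nonneg fun i (_ : i ∈ Finset.univ) => h1 i
      have h5 := Finset.sum_nonneg fun i (_ : i ∈ Finset.univ) => h2 i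
      linarith
    ext ⟨i, hi⟩
    have h4 := (Finset.sum_eq_zero_iff_of_nonneg fun i _ => h2 i).1 h3 i (Finset.mem_univ i)
    have h5 : ext y i = 0 := by simpa [hi.ne'] using h4
    simpa [ext, hi] using h5
  simpa using LinearMap.finrank_le_finrank_of_injective hinj

/-- Every residue field is nonreal, so it contains a root of `-1`. The Chinese remainder theorem
combines these modulo the nilradical, and Newton's method lifts the result, the derivative `2 * j`
being a unit. -/
theorem exists_sq_eq_neg_one {B : Type*} [CommRing B] [Algebra ℝ B] [Module.Finite ℝ B]
    (h : IsEmpty (B →ₐ[ℝ] ℝ)) : ∃ j : B, j ^ 2 = -1 := by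
  have hart : IsArtinianRing B := IsArtinianRing.of_finite ℝ B
  have hfield : ∀ m : MaximalSpectrum B, ∃ y : B, Ideal.Quotient.mk m.asIdeal (y ^ 2 + 1) = 0 := by
    intro m
    have := m.isMaximal
    let _ : Field (B ⧸ m.asIdeal) := Ideal.Quotient.field _
    let σ : (B ⧸ m.asIdeal) →ₐ[ℝ] ℂ := IsAlgClosed.lift
    by_cases hre : ∀ x, (σ x).im = 0
    · refine h.elim (AlgHom.comp ?_ (Ideal.Quotient.mkₐ ℝ m.asIdeal))
      exact
        { toFun := fun x => (σ x).re
          map_one' := by simp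
          map_mul' := fun x y => by simp [hre]
          map_zero' := by simp
          map_add' := fun x y => by simp
          commutes' := fun r => by simp }
    · push Not at hre
      obtain ⟨x, hx⟩ := hre
      let y := (x - algebraMap ℝ _ (σ x).re) * algebraMap ℝ _ (σ x).im⁻¹
      have hy : σ y = Complex.I := by
        simp only [y, map_mul, map_sub, AlgHom.commutes]
        apply Complex.ext <;> simp [hx]
      obtain ⟨z, hz⟩ := Ideal.Quotient.mk_surjective y
      refine ⟨z, σ.toRingHom.injective ?_⟩
      rw [map_add, map_pow, hz, map_one, map_zero]
      change σ (y ^ 2 + 1) = 0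
      rw [map_add, map_pow, hy, map_one, Complex.I_sq]; ring
  choose y hy using hfield
  have hfin : Finite (MaximalSpectrum B) := inferInstance
  obtain ⟨j, hj⟩ : ∃ j : B, ∀ m : MaximalSpectrum B, j - y m ∈ m.asIdeal := by
    have hcop : Pairwise fun m n : MaximalSpectrum B => IsCoprime m.asIdeal n.asIdeal := by
      intro m n hmn
      rw [Ideal.isCoprime_iff_sup_eq]
      exact m.isMaximal.coprime_of_ne n.isMaximal (fun he => hmn (MaximalSpectrum.ext he))
    obtain ⟨j, hj⟩ := Ideal.quotientInfToPiQuotient_surj hcop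
      (fun m => Ideal.Quotient.mk m.asIdeal (y m))
    obtain ⟨j, rfl⟩ := Ideal.Quotient.mk_surjective j
    refine ⟨j, fun m => ?_⟩
    rw [← Ideal.Quotient.eq]
    exact congrFun hj m
  have hmem : ∀ m : MaximalSpectrum B, j ^ 2 + 1 ∈ m.asIdeal := by
    intro m
    have h1 : (y m) ^ 2 + 1 ∈ m.asIdeal := Ideal.Quotient.eq_zero_iff_mem.1 (hy m)
    have h2 := m.asIdeal.mul_mem_left (j + y m) (hj m)
    have := m.asIdeal.add_mem h1 h2
    convert this using 1; ring
  have hnil : IsNilpotent (j ^ 2 + 1) := by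
    rw [nilpotent_iff_mem_prime]
    intro J hJ
    have := IsArtinianRing.isMaximal_of_isPrime J
    exact hmem ⟨J, this⟩
  have hunit : IsUnit j := by
    have h1 : IsUnit (-(j ^ 2)) := by
      have := hnil.isUnit_one_sub
      convert this using 1; ring
    rw [IsUnit.neg_iff] at h1
    exact (isUnit_pow_iff two_ne_zero).1 h1
  obtain ⟨r, ⟨-, hr⟩, -⟩ := existsUnique_nilpotent_sub_and_aeval_eq_zero
    (P := (X ^ 2 + 1 : ℝ[X])) (x := j) (by simpa using hnil) (by
      have h2 : IsUnit (algebraMap ℝ B 2) := (IsUnit.mk0 (2 : ℝ) two_ne_zero).map _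
      have := h2.mul hunit
      simpa [one_add_one_eq_two] using this)
  refine ⟨r, ?_⟩
  have hr' : r ^ 2 + 1 = 0 := by simpa using hr
  linear_combination hr'

end Signature

end RealClosure

/-! ### Positive signature of the trace form. -/

namespace RealClosure

open Polynomial

/-- Each two-element orbit of the involution contributes one `σ < c σ`, and the fixed point
contributes none. -/
theorem two_mul_card_lt {E : Type*} [Fintype E] [LinearOrder E] (c : E → E) (hc : ∀ σ, c (c σ) = σ)
    {σ₀ : E} (h₀ : c σ₀ = σ₀) : 2 * Fintype.card {σ // σ < c σ} < Fintype.card E := by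
  classical
  let e : {σ // σ < c σ} ≃ {σ // c σ < σ} :=
    { toFun := fun σ => ⟨c σ, by rw [hc]; exact σ.2⟩
      invFun := fun σ => ⟨c σ, by rw [hc]; exact σ.2⟩
      left_inv := fun σ => Subtype.ext (hc σ)
      right_inv := fun σ => Subtype.ext (hc σ) }
  have h1 : Fintype.card {σ // c σ < σ} + Fintype.card {σ // σ < c σ} < Fintype.card E := by
    rw [Fintype.card_subtype, Fintype.card_subtype, ← Finset.card_union_of_disjoint]
    · refine Finset.card_lt_univ_of_notMem (x := σ₀) ?_
      simp [h₀]
    · rw [Finset.disjoint_filter]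
      exact fun σ _ h => h.le.not_gt
  rw [← Fintype.card_congr e] at h1
  omega

variable {K : Type*} [Field K] [IsRealClosed K] [LinearOrder K] [IsStrictOrderedRing K]

/-- The trace form of a finite extension that embeds in a real closed field has positive
signature. -/
theorem card_neg_lt_card_pos {F L ι : Type*} [Field F] [Field L] [Algebra F L]
    [FiniteDimensional F L] [Algebra F K] (φ : L →ₐ[F] K) [Fintype ι] [DecidableEq ι]
    (b : Module.Basis ι F L) (d : ι → F)
    (hb : ∀ i j, Algebra.trace F L (b i * b j) = if i = j then d i else 0) (hd : ∀ i, d i ≠ 0) :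
    Fintype.card {i // algebraMap F K (d i) < 0} < Fintype.card {i // 0 < algebraMap F K (d i)} := by
  classical
  have : CharZero F := (algebraMap F K).charZero
  let Ω := AlgebraicClosure K
  obtain ⟨c, hcc, hcK, w, hw⟩ := exists_conj K Ω
  -- Conjugation permutes the embeddings into `Ω` and fixes the one coming from `φ`, so fewer than
  -- half as many conjugate pairs as embeddings exist. Under `hle` the negative subspace has at
  -- least half the full dimension. Being real at one embedding of each pair is one linear
  -- condition, so some nonzero negative vector is real at all embeddings. Its trace form is then a
  -- sum of squares in `K`, a contradiction.
  by_contra! hle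
  have hcard : Fintype.card (L →ₐ[F] Ω) = Fintype.card ι := by
    rw [AlgHom.card F L Ω, Module.finrank_eq_card_basis b]
  let _ : LinearOrder (L →ₐ[F] Ω) := LinearOrder.lift' _ (Fintype.equivFin (L →ₐ[F] Ω)).injective
  let C : (L →ₐ[F] Ω) → (L →ₐ[F] Ω) := fun σ => ((c : Ω →ₐ[K] Ω).restrictScalars F).comp σ
  have hC : ∀ σ x, C σ x = c (σ x) := fun σ x => rfl
  have hCC : ∀ σ, C (C σ) = σ := fun σ => AlgHom.ext fun x => by rw [hC, hC, hcc]
  let σ₀ : L →ₐ[F] Ω := (IsScalarTower.toAlgHom F K Ω).comp φ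
  have hσ₀ : C σ₀ = σ₀ := AlgHom.ext fun x => c.commutes _
  have hlt := two_mul_card_lt C hCC hσ₀
  have hsplit : Fintype.card {i // 0 < algebraMap F K (d i)} +
      Fintype.card {i // algebraMap F K (d i) < 0} = Fintype.card ι := by
    rw [Fintype.card_subtype, Fintype.card_subtype, ← Finset.card_union_of_disjoint]
    · rw [← Finset.card_univ]
      congr 1
      ext i
      have := hd i
      simp only [Finset.mem_union, Finset.mem_filter, Finset.mem_univ, true_and, iff_true]
      exact (lt_or_gt_of_ne ((map_ne_zero (algebraMap F K)).2 this)).symm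
    · rw [Finset.disjoint_filter]
      exact fun σ _ h => h.le.not_gt
  let N := {i // algebraMap F K (d i) < 0}
  let R := LinearMap.range (Algebra.linearMap K Ω)
  have hspan : ∀ q : Ω ⧸ R, ∃ t : K, t • R.mkQ w = q := by
    intro q
    obtain ⟨z, rfl⟩ := R.mkQ_surjective q
    obtain ⟨x, y, rfl⟩ := hw z
    refine ⟨y, ?_⟩
    rw [← map_smul, Algebra.smul_def, ← sub_eq_zero, ← map_sub, ← LinearMap.mem_ker,
      Submodule.ker_mkQ]
    exact ⟨-x, by simp⟩
  have hfin : Module.Finite K (Ω ⧸ R) :=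
    Module.Finite.of_surjective (LinearMap.toSpanSingleton K _ (R.mkQ w)) hspan
  have hone : Module.finrank K (Ω ⧸ R) ≤ 1 := finrank_le_one _ hspan
  let G : (L →ₐ[F] Ω) → (N → K) →ₗ[K] Ω := fun σ =>
    Fintype.linearCombination K (fun i : N => σ (b i))
  have hG : ∀ σ κ, G σ κ = ∑ i, algebraMap K Ω (κ i) * σ (b i) := by
    intro σ κ
    simp only [G, Fintype.linearCombination_apply, Algebra.smul_def]
  let Φ : (N → K) →ₗ[K] ({σ // σ < C σ} → Ω ⧸ R) := LinearMap.pi fun σ => R.mkQ ∘ₗ G σ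
  have hker : LinearMap.ker Φ ≠ ⊥ := by
    apply LinearMap.ker_ne_bot_of_finrank_lt
    rw [Module.finrank_pi_fintype, Module.finrank_fintype_fun_eq_card, Finset.sum_const,
      Finset.card_univ, smul_eq_mul]
    calc _ ≤ Fintype.card {σ // σ < C σ} * 1 := Nat.mul_le_mul_left _ hone
      _ < Fintype.card N := by
        have : Fintype.card N = Fintype.card {i // algebraMap F K (d i) < 0} := rfl
        omega
  obtain ⟨κ, hκ, hκ0⟩ := Submodule.exists_mem_ne_zero_of_ne_bot hker
  have hneg : ∀ σ, σ < C σ → G σ κ ∈ R := by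
    intro σ hσ
    have := congrFun (LinearMap.mem_ker.1 hκ) ⟨σ, hσ⟩
    rw [← Submodule.ker_mkQ R]
    exact this
  have hGC : ∀ σ, G (C σ) κ = c (G σ κ) := by
    intro σ
    rw [hG, hG, map_sum]
    refine Finset.sum_congr rfl fun i _ => ?_
    rw [map_mul, c.commutes, hC]
  have hall : ∀ σ, ∃ t : K, algebraMap K Ω t = G σ κ := by
    intro σ
    rcases lt_trichotomy σ (C σ) with h | h | h
    · exact hneg σ h
    · exact hcK _ (by rw [← hGC, ← h])
    · obtain ⟨t, ht⟩ := hneg (C σ) (by rwa [hCC])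
      refine ⟨t, ?_⟩
      have h1 := hGC (C σ)
      rw [hCC, ← ht] at h1
      rw [h1]
      exact (c.commutes t).symm
  choose t ht using hall
  have hsum : ∑ σ, t σ ^ 2 = ∑ i : N, algebraMap F K (d i) * κ i ^ 2 := by
    apply (algebraMap K Ω).injective
    rw [map_sum, map_sum]
    have h1 : ∀ i j : N, ∑ σ : L →ₐ[F] Ω, σ (b i) * σ (b j) =
        if i = j then algebraMap K Ω (algebraMap F K (d i)) else 0 := by
      intro i j
      have h2 := trace_eq_sum_embeddings (K := F) Ω (x := b i * b j)
      rw [hb] at h2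
      simp only [map_mul] at h2
      rw [← h2]
      by_cases hij : i = j
      · subst hij; simp [← IsScalarTower.algebraMap_apply F K Ω]
      · have : (i : ι) ≠ j := fun h => hij (Subtype.ext h)
        simp [hij, this]
    calc ∑ σ, algebraMap K Ω (t σ ^ 2)
        = ∑ σ : L →ₐ[F] Ω, ∑ i : N, ∑ j : N, (algebraMap K Ω (κ i) * algebraMap K Ω (κ j)) *
            (σ (b i) * σ (b j)) := by
          refine Finset.sum_congr rfl fun σ _ => ?_
          rw [map_pow, ht, hG, sq, Finset.sum_mul_sum]
          refine Finset.sum_congr rfl fun i _ => Finset.sum_congr rfl fun j _ => by ring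
      _ = ∑ i : N, ∑ j : N, (algebraMap K Ω (κ i) * algebraMap K Ω (κ j)) *
            ∑ σ : L →ₐ[F] Ω, (σ (b i) * σ (b j)) := by
          rw [Finset.sum_comm]
          refine Finset.sum_congr rfl fun i _ => ?_
          rw [Finset.sum_comm]
          refine Finset.sum_congr rfl fun j _ => ?_
          rw [Finset.mul_sum]
      _ = _ := by
          refine Finset.sum_congr rfl fun i _ => ?_
          rw [Finset.sum_eq_single i, h1, if_pos rfl, map_mul, map_pow]
          · ring
          · intro j _ hj
            rw [h1, if_neg hj.symm, mul_zero]
          · simp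
  have hnonneg : 0 ≤ ∑ σ, t σ ^ 2 := Finset.sum_nonneg fun σ _ => sq_nonneg _
  rw [hsum] at hnonneg
  have hnonpos : ∀ i : N, algebraMap F K (d i) * κ i ^ 2 ≤ 0 := fun i =>
    mul_nonpos_of_nonpos_of_nonneg i.2.le (sq_nonneg _)
  have hzero := (Finset.sum_eq_zero_iff_of_nonpos fun i _ => hnonpos i).1
    (le_antisymm (Finset.sum_nonpos fun i _ => hnonpos i) hnonneg)
  refine hκ0 (funext fun i => ?_)
  have := hzero i (Finset.mem_univ i)
  simpa [i.2.ne] using this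

end RealClosure

/-! ### Specializing the trace form to the real numbers. -/

namespace RealClosure

open Polynomial

/-- Evaluating coordinates by `ev` makes the `A`-span `O` of the basis into a finite real algebra `O
⧸ I` carrying the specialized form. Without a real character, `-1` is a square there, and
multiplication by its root negates the form, against `hsig`. -/
theorem exists_algHom_of_basis {F L ι : Type*} [Field F] [Field L] [Algebra ℝ F] [Algebra ℝ L]
    [Algebra F L] [IsScalarTower ℝ F L] [Fintype ι] [DecidableEq ι]
    (b : Module.Basis ι F L) (d : ι → F)
    (hb : ∀ i j, Algebra.trace F L (b i * b j) = if i = j then d i else 0)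
    (A : Subalgebra ℝ F) (ev : A →ₐ[ℝ] ℝ) (hone : ∀ i, b.repr 1 i ∈ A)
    (hmul : ∀ i j k, b.repr (b i * b j) k ∈ A) (hdA : ∀ i, d i ∈ A)
    (hd : ∀ i, ev ⟨d i, hdA i⟩ ≠ 0)
    (hsig : Fintype.card {i // ev ⟨d i, hdA i⟩ < 0} < Fintype.card {i // 0 < ev ⟨d i, hdA i⟩}) :
    ∃ O : Subalgebra ℝ L, (∀ x, (∀ i, b.repr x i ∈ A) → x ∈ O) ∧ Nonempty (O →ₐ[ℝ] ℝ) := by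
  have hreprmul : ∀ x y k, b.repr (x * y) k =
      ∑ i, ∑ j, b.repr x i * b.repr y j * b.repr (b i * b j) k := by
    intro x y k
    conv_lhs => rw [← b.sum_repr x, ← b.sum_repr y]
    simp only [Finset.sum_mul_sum, smul_mul_smul_comm, map_sum, map_smul, Finsupp.coe_finsetSum,
      Finset.sum_apply, Finsupp.smul_apply, smul_eq_mul]
  have htr : ∀ x y, Algebra.trace F L (x * y) = ∑ i, b.repr x i * b.repr y i * d i := by
    intro x y
    conv_lhs => rw [← b.sum_repr x, ← b.sum_repr y]
    simp only [Finset.sum_mul_sum, smul_mul_smul_comm, map_sum, map_smul, hb, smul_eq_mul,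
      mul_ite, mul_zero, Finset.sum_ite_eq, Finset.mem_univ, if_true]
  have hreprsmul : ∀ (r : ℝ) (x : L) (i : ι), b.repr (r • x) i = r • b.repr x i := by
    intro r x i
    rw [← algebraMap_smul F r x, map_smul, Finsupp.smul_apply, algebraMap_smul]
  let O : Subalgebra ℝ L :=
    { carrier := {x | ∀ i, b.repr x i ∈ A}
      mul_mem' := fun {x y} hx hy k => by
        rw [hreprmul]
        exact A.sum_mem fun i _ => A.sum_mem fun j _ => A.mul_mem (A.mul_mem (hx i) (hy j)) (hmul i j k)
      add_mem' := fun {x y} hx hy i => by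
        rw [map_add, Finsupp.add_apply]; exact A.add_mem (hx i) (hy i)
      algebraMap_mem' := fun r i => by
        rw [Algebra.algebraMap_eq_smul_one, hreprsmul]; exact A.smul_mem (hone i) r }
  refine ⟨O, fun x hx => hx, ?_⟩
  by_contra hcon
  let π : O →ₗ[ℝ] (ι → ℝ) :=
    { toFun := fun x i => ev ⟨b.repr x i, x.2 i⟩
      map_add' := fun x y => by
        ext i
        rw [Pi.add_apply, ← map_add]
        congr 1
        apply Subtype.ext
        simp
      map_smul' := fun r x => by
        ext i
        rw [Pi.smul_apply, RingHom.id_apply, ← map_smul]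
        congr 1
        apply Subtype.ext
        exact hreprsmul r x i }
  have hπ : ∀ x i, π x i = ev ⟨b.repr x i, x.2 i⟩ := fun x i => rfl
  let c : ι → ι → ι → ℝ := fun i j k => ev ⟨b.repr (b i * b j) k, hmul i j k⟩
  let D : ι → ℝ := fun i => ev ⟨d i, hdA i⟩
  have hπmul : ∀ x y k, π (x * y) k = ∑ i, ∑ j, π x i * π y j * c i j k := by
    intro x y k
    simp only [hπ, c, ← map_mul, ← map_sum]
    congr 1
    apply Subtype.ext
    simpa using hreprmul x y k
  -- The specialized form depends only on the product `x * y`, as the trace form does; hence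
  -- multiplying both arguments by `j` multiplies it by `j ^ 2 = -1`.
  have hQ : ∀ x y, ∑ i, π (x * y) i * π 1 i * D i = ∑ i, π x i * π y i * D i := by
    intro x y
    simp only [hπ, D, ← map_mul, ← map_sum]
    congr 1
    apply Subtype.ext
    have := htr (x * y) 1
    rw [mul_one, htr] at this
    simpa using this.symm
  let I : Ideal O :=
    { carrier := {x | π x = 0}
      zero_mem' := map_zero π
      add_mem' := fun {x y} (hx : π x = 0) (hy : π y = 0) => by
        change π (x + y) = 0
        rw [map_add, hx, hy, add_zero]
      smul_mem' := fun x y (hy : π y = 0) => by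
        change π (x * y) = 0
        ext k
        simp [hπmul, hy] }
  have hI : ∀ x, x ∈ I ↔ π x = 0 := fun x => Iff.rfl
  have hbO : ∀ i, b i ∈ O := by
    intro i k
    rw [b.repr_self, Finsupp.single_apply]
    split_ifs
    exacts [A.one_mem, A.zero_mem]
  have hπb : ∀ i k, π ⟨b i, hbO i⟩ k = if i = k then 1 else 0 := by
    intro i k
    rw [hπ]
    split_ifs with h
    · rw [← map_one ev]
      congr 1
      apply Subtype.ext
      simp [h]
    · rw [← map_zero ev]
      congr 1
      apply Subtype.ext
      simp [h]
  let s : (ι → ℝ) →ₗ[ℝ] O := Fintype.linearCombination ℝ fun i => ⟨b i, hbO i⟩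
  have hs : ∀ r, π (s r) = r := by
    intro r
    ext k
    simp only [s, Fintype.linearCombination_apply, map_sum, map_smul, Finset.sum_apply,
      Pi.smul_apply, hπb, smul_eq_mul, mul_ite, mul_one, mul_zero, Finset.sum_ite_eq',
      Finset.mem_univ, if_true]
  have hfin : Module.Finite ℝ (O ⧸ I) := by
    refine Module.Finite.of_surjective ((Ideal.Quotient.mkₐ ℝ I).toLinearMap ∘ₗ s) fun q => ?_
    obtain ⟨x, rfl⟩ := Ideal.Quotient.mk_surjective q
    refine ⟨π x, ?_⟩
    change Ideal.Quotient.mk I (s (π x)) = _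
    rw [Ideal.Quotient.eq, hI, map_sub, hs, sub_self]
  obtain ⟨j, hj⟩ := exists_sq_eq_neg_one (B := O ⧸ I)
    ⟨fun χ => hcon ⟨χ.comp (Ideal.Quotient.mkₐ ℝ I)⟩⟩
  obtain ⟨j, rfl⟩ := Ideal.Quotient.mk_surjective j
  have hjI : j ^ 2 + 1 ∈ I := by
    rw [← Ideal.Quotient.eq_zero_iff_mem, map_add, map_pow, hj, map_one]; ring
  refine (card_pos_le_card_neg (D := D) hd
    (π ∘ₗ (LinearMap.mulLeft ℝ j) ∘ₗ s) fun r => ?_).not_gt hsig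
  have h1 := hQ (j * s r) (j * s r)
  have h2 := hQ (s r) (s r)
  have h3 : π (j * s r * (j * s r)) = -π (s r * s r) := by
    have h4 : π ((s r * s r) * (j ^ 2 + 1)) = 0 := (hI _).1 (I.mul_mem_left _ hjI)
    have h5 : j * s r * (j * s r) = (s r * s r) * (j ^ 2 + 1) - s r * s r := by ring
    rw [h5, map_sub, h4, zero_sub]
  rw [h3] at h1
  simp only [Pi.neg_apply, neg_mul, Finset.sum_neg_distrib] at h1
  rw [h2, hs] at h1
  have h6 : ∑ i, D i * (π ∘ₗ (LinearMap.mulLeft ℝ j) ∘ₗ s) r i ^ 2 =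
      ∑ i, π (j * s r) i * π (j * s r) i * D i :=
    Finset.sum_congr rfl fun i _ => by
      simp only [LinearMap.comp_apply, LinearMap.mulLeft_apply]; ring
  rw [h6, ← h1]
  congr 1
  exact Finset.sum_congr rfl fun i _ => by ring

end RealClosure

/-! ### Sign-preserving specializations: constants and algebraic elements. -/

namespace RealClosure

open Polynomial

variable {K : Type*} [Field K] [Algebra ℝ K] [LinearOrder K] [IsStrictOrderedRing K]

/-- Every finite subset of `F` has a real specialization that respects signs. -/
def HasSpecializations (F : IntermediateField ℝ K) : Prop :=
  ∀ S : Finset K, (∀ c ∈ S, c ∈ F) → ∃ (A : Subalgebra ℝ K) (hS : ∀ c ∈ S, c ∈ A) (ev : A →ₐ[ℝ] ℝ),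
    ∀ c (hc : c ∈ S), 0 < c → 0 < ev ⟨c, hS c hc⟩

theorem hasSpecializations_bot : HasSpecializations (⊥ : IntermediateField ℝ K) := by
  intro S hS
  refine ⟨(⊥ : Subalgebra ℝ K), fun c hc => ?_, (Algebra.botEquiv ℝ K : _ →ₐ[ℝ] ℝ),
    fun c hc hpos => ?_⟩
  · obtain ⟨r, hr⟩ := IntermediateField.mem_bot.1 (hS c hc)
    exact Algebra.mem_bot.2 ⟨r, hr⟩
  · obtain ⟨r, rfl⟩ := IntermediateField.mem_bot.1 (hS c hc)
    have h1 : (Algebra.botEquiv ℝ K) ⟨algebraMap ℝ K r, Algebra.mem_bot.2 ⟨r, rfl⟩⟩ = r :=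
      (Algebra.botEquiv ℝ K).commutes r
    change 0 < (Algebra.botEquiv ℝ K) ⟨algebraMap ℝ K r, _⟩
    rw [h1]
    by_contra! hr
    have h2 : algebraMap ℝ K r = -(algebraMap ℝ K (√(-r))) ^ 2 := by
      rw [← map_pow, Real.sq_sqrt (by linarith), map_neg, neg_neg]
    rw [h2] at hpos
    nlinarith [sq_nonneg (algebraMap ℝ K (√(-r)))]

variable [IsRealClosed K]

theorem HasSpecializations.exists_algHom_of_finiteDimensional {F : IntermediateField ℝ K}
    (hF : HasSpecializations F) (L : IntermediateField F K) [FiniteDimensional F L]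
    (T : Finset K) (hT : ∀ c ∈ T, c ∈ L) :
    ∃ A : Subalgebra ℝ K, (∀ c ∈ T, c ∈ A) ∧ Nonempty (A →ₐ[ℝ] ℝ) := by
  classical
  have : CharZero F := (algebraMap F K).charZero
  have h2 : Invertible (2 : F) := invertibleOfNonzero two_ne_zero
  obtain ⟨b, hb⟩ := LinearMap.BilinForm.exists_orthogonal_basis
    (B := Algebra.traceForm F L)
    ⟨fun x y => by simp [Algebra.traceForm_apply, mul_comm]⟩
  let d : Fin (Module.finrank F L) → F := fun i => Algebra.trace F L (b i * b i)
  have hd : ∀ i, d i ≠ 0 := hb.not_isOrtho_basis_self_of_separatingLeft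
    (traceForm_nondegenerate F L).1
  have hbd : ∀ i j, Algebra.trace F L (b i * b j) = if i = j then d i else 0 := by
    intro i j
    split_ifs with h
    · rw [h]
    · exact hb h
  have hsig := card_neg_lt_card_pos (K := K) L.val b d hbd hd
  let ι := Fin (Module.finrank F L)
  -- All coefficients that `O` depends on, the coordinates of `T`, and both signs of `d i`, because
  -- a specialization is only required to respect positive elements.
  let V : Set K := (Set.range fun i : ι => (b.repr 1 i : K)) ∪
    ((Set.range fun i : ι × ι × ι => (b.repr (b i.1 * b i.2.1) i.2.2 : K)) ∪
    ((Set.range fun t : T × ι => (b.repr ⟨t.1, hT t.1 t.1.2⟩ t.2 : K)) ∪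
    ((Set.range fun i : ι => (d i : K)) ∪ Set.range fun i : ι => -(d i : K))))
  have hV : V.Finite := (Set.finite_range _).union ((Set.finite_range _).union
    ((Set.finite_range _).union ((Set.finite_range _).union (Set.finite_range _))))
  let U := hV.toFinset
  have hVU : ∀ x ∈ V, x ∈ U := fun x hx => hV.mem_toFinset.2 hx
  have hU1 : ∀ i, (b.repr 1 i : K) ∈ U := fun i => hVU _ (.inl ⟨i, rfl⟩)
  have hU2 : ∀ i j k, (b.repr (b i * b j) k : K) ∈ U := fun i j k =>
    hVU _ (.inr (.inl ⟨(i, j, k), rfl⟩))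
  have hU3 : ∀ t (ht : t ∈ T) i, (b.repr ⟨t, hT t ht⟩ i : K) ∈ U := fun t ht i =>
    hVU _ (.inr (.inr (.inl ⟨(⟨t, ht⟩, i), rfl⟩)))
  have hU4 : ∀ i, (d i : K) ∈ U := fun i => hVU _ (.inr (.inr (.inr (.inl ⟨i, rfl⟩))))
  have hU5 : ∀ i, -(d i : K) ∈ U := fun i => hVU _ (.inr (.inr (.inr (.inr ⟨i, rfl⟩))))
  obtain ⟨A₀, hA₀, ev₀, hpos⟩ := hF U (by
    intro c hc
    rcases hV.mem_toFinset.1 hc with ⟨i, rfl⟩ | ⟨i, rfl⟩ | ⟨i, rfl⟩ | ⟨i, rfl⟩ | ⟨i, rfl⟩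
    · exact SetLike.coe_mem _
    · exact SetLike.coe_mem _
    · exact SetLike.coe_mem _
    · exact SetLike.coe_mem _
    · exact F.neg_mem (SetLike.coe_mem _))
  let A : Subalgebra ℝ F := A₀.comap F.val
  let ev : A →ₐ[ℝ] ℝ := ev₀.comp
    ((F.val.comp A.val).codRestrict A₀ fun x => x.2)
  have hev : ∀ x : A, ev x = ev₀ ⟨(x : F), x.2⟩ := fun x => rfl
  have hdA : ∀ i, d i ∈ A := fun i => hA₀ _ (hU4 i)
  have hdpos : ∀ i, 0 < (d i : K) → 0 < ev ⟨d i, hdA i⟩ := fun i hi => hpos _ (hU4 i) hi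
  have hdneg : ∀ i, (d i : K) < 0 → ev ⟨d i, hdA i⟩ < 0 := fun i hi => by
    have h3 := hpos _ (hU5 i) (by linarith)
    have h4 : ev ⟨d i, hdA i⟩ = -ev₀ ⟨-(d i : K), hA₀ _ (hU5 i)⟩ := by
      rw [hev, ← map_neg]
      congr 1
      apply Subtype.ext
      simp
    linarith
  have hdK : ∀ i, (d i : K) < 0 ∨ 0 < (d i : K) := fun i =>
    lt_or_gt_of_ne fun h => hd i (Subtype.ext h)
  obtain ⟨O, hO, ⟨χ⟩⟩ := exists_algHom_of_basis b d hbd A ev (fun i => hA₀ _ (hU1 i))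
    (fun i j k => hA₀ _ (hU2 i j k)) hdA
    (fun i => (hdK i).elim (fun h => (hdneg i h).ne) fun h => (hdpos i h).ne') (by
      have e1 : ∀ i, ev ⟨d i, hdA i⟩ < 0 ↔ algebraMap F K (d i) < 0 := fun i =>
        ⟨fun h => (hdK i).resolve_right fun h' => (hdpos i h').not_gt h, hdneg i⟩
      have e2 : ∀ i, 0 < ev ⟨d i, hdA i⟩ ↔ 0 < algebraMap F K (d i) := fun i =>
        ⟨fun h => (hdK i).resolve_left fun h' => (hdneg i h').not_gt h, hdpos i⟩
      rw [Fintype.card_congr (Equiv.subtypeEquivRight e1),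
        Fintype.card_congr (Equiv.subtypeEquivRight e2)]
      exact hsig)
  let ψ : L →ₐ[ℝ] K := L.val.restrictScalars ℝ
  refine ⟨O.map ψ, fun c hc => ⟨⟨c, hT c hc⟩, hO _ fun i => hA₀ _ (hU3 c hc i), rfl⟩,
    ⟨χ.comp (O.equivMapOfInjective ψ ψ.toRingHom.injective).symm.toAlgHom⟩⟩

/-- A positive element has a square root in `K`. Specializing this root together with its inverse
forces the value of the element to be a nonzero square. -/
theorem HasSpecializations.exists_algHom_of_isIntegral {F : IntermediateField ℝ K}
    (hF : HasSpecializations F) (T : Finset K) (hT : ∀ c ∈ T, IsIntegral F c) :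
    ∃ (A : Subalgebra ℝ K) (hS : ∀ c ∈ T, c ∈ A) (ev : A →ₐ[ℝ] ℝ),
      ∀ c (hc : c ∈ T), 0 < c → 0 < ev ⟨c, hS c hc⟩ := by
  classical
  have hsq : ∀ c : K, ∃ s : K, 0 < c → s ^ 2 = c := by
    intro c
    by_cases hc : 0 < c
    · obtain ⟨s, hs⟩ := IsRealClosed.exists_eq_pow_of_nonneg hc.le two_ne_zero
      exact ⟨s, fun _ => hs.symm⟩
    · exact ⟨0, fun h => absurd h hc⟩
  choose s hs using hsq
  let R : Finset K := (T.filter fun c => 0 < c).image s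
  have hR : ∀ x ∈ R, IsIntegral F x := by
    intro x hx
    obtain ⟨c, hc, rfl⟩ := Finset.mem_image.1 hx
    obtain ⟨hc, hpos⟩ := Finset.mem_filter.1 hc
    refine IsIntegral.of_pow (n := 2) two_pos ?_
    rw [hs c hpos]
    exact hT c hc
  let U : Finset K := T ∪ R
  let L : IntermediateField F K := IntermediateField.adjoin F (U : Set K)
  have hUL : ∀ x ∈ U, x ∈ L := fun x hx => IntermediateField.subset_adjoin F _ hx
  have : FiniteDimensional F L := IntermediateField.finiteDimensional_adjoin fun x hx => by
    rcases Finset.mem_union.1 hx with h | h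
    exacts [hT x h, hR x h]
  obtain ⟨A, hA, ⟨ev⟩⟩ := hF.exists_algHom_of_finiteDimensional L (U ∪ R.image fun x => x⁻¹) (by
    intro c hc
    rcases Finset.mem_union.1 hc with h | h
    · exact hUL c h
    · obtain ⟨x, hx, rfl⟩ := Finset.mem_image.1 h
      exact L.inv_mem (hUL x (Finset.mem_union_right _ hx)))
  refine ⟨A, fun c hc => hA c (Finset.mem_union_left _ (Finset.mem_union_left _ hc)), ev,
    fun c hc hpos => ?_⟩
  have hcR : s c ∈ R := Finset.mem_image_of_mem _ (Finset.mem_filter.2 ⟨hc, hpos⟩)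
  have h1 : s c ∈ A := hA _ (Finset.mem_union_left _ (Finset.mem_union_right _ hcR))
  have h2 : (s c)⁻¹ ∈ A := hA _ (Finset.mem_union_right _ (Finset.mem_image_of_mem _ hcR))
  have hs0 : s c ≠ 0 := by
    intro h0
    have := hs c hpos
    rw [h0] at this
    simp at this
    exact hpos.ne this
  have h3 : ev ⟨s c, h1⟩ * ev ⟨(s c)⁻¹, h2⟩ = 1 := by
    rw [← map_mul, ← map_one ev]
    congr 1
    exact Subtype.ext (mul_inv_cancel₀ hs0)
  have h4 : ev ⟨c, hA c (Finset.mem_union_left _ (Finset.mem_union_left _ hc))⟩ =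
      ev ⟨s c, h1⟩ ^ 2 := by
    rw [← map_pow]
    congr 1
    exact Subtype.ext (hs c hpos).symm
  rw [h4]
  have : ev ⟨s c, h1⟩ ≠ 0 := left_ne_zero_of_mul_eq_one h3
  positivity

end RealClosure

/-! ### Transcendental elements and the Artin–Lang theorem. -/

namespace RealClosure

open Polynomial

/-- The gap of `Z` containing `τ` has an integral point: the midpoint of its ends, a shift by one of
its only end, or `0` if `Z` is empty. -/
theorem exists_isIntegral_same_side {F K : Type*} [Field F] [Field K] [LinearOrder K]
    [IsStrictOrderedRing K] [Algebra F K] (Z : Finset K) (hZ : ∀ z ∈ Z, IsIntegral F z) {τ : K}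
    (hτ : τ ∉ Z) : ∃ r : K, IsIntegral F r ∧ ∀ z ∈ Z, (z < τ ∧ z < r) ∨ (τ < z ∧ r < z) := by
  have hside : ∀ z ∈ Z, z < τ ∨ τ < z := fun z hz => lt_or_gt_of_ne fun h => hτ (h ▸ hz)
  rcases (Z.filter (· < τ)).eq_empty_or_nonempty with hl | hl <;>
  rcases (Z.filter (τ < ·)).eq_empty_or_nonempty with hu | hu
  · refine ⟨0, isIntegral_zero, fun z hz => ?_⟩
    rcases hside z hz with h | h
    · exact absurd (Finset.mem_filter.2 ⟨hz, h⟩) (hl ▸ Finset.notMem_empty z)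
    · exact absurd (Finset.mem_filter.2 ⟨hz, h⟩) (hu ▸ Finset.notMem_empty z)
  · refine ⟨(Z.filter (τ < ·)).min' hu - 1,
      (hZ _ (Finset.mem_filter.1 (Finset.min'_mem _ hu)).1).sub isIntegral_one, fun z hz => ?_⟩
    rcases hside z hz with h | h
    · exact absurd (Finset.mem_filter.2 ⟨hz, h⟩) (hl ▸ Finset.notMem_empty z)
    · have := (Z.filter (τ < ·)).min'_le z (Finset.mem_filter.2 ⟨hz, h⟩)
      exact .inr ⟨h, by linarith⟩
  · refine ⟨(Z.filter (· < τ)).max' hl + 1,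
      (hZ _ (Finset.mem_filter.1 (Finset.max'_mem _ hl)).1).add isIntegral_one, fun z hz => ?_⟩
    rcases hside z hz with h | h
    · have := (Z.filter (· < τ)).le_max' z (Finset.mem_filter.2 ⟨hz, h⟩)
      exact .inl ⟨h, by linarith⟩
    · exact absurd (Finset.mem_filter.2 ⟨hz, h⟩) (hu ▸ Finset.notMem_empty z)
  · have hlm := Finset.mem_filter.1 (Finset.max'_mem _ hl)
    have hum := Finset.mem_filter.1 (Finset.min'_mem _ hu)
    refine ⟨((Z.filter (· < τ)).max' hl + (Z.filter (τ < ·)).min' hu) * algebraMap F K 2⁻¹,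
      ((hZ _ hlm.1).add (hZ _ hum.1)).mul isIntegral_algebraMap, fun z hz => ?_⟩
    have h2 : algebraMap F K 2⁻¹ = 2⁻¹ := by rw [map_inv₀, map_ofNat]
    rw [h2]
    have h3 := hlm.2.trans hum.2
    rcases hside z hz with h | h
    · have := (Z.filter (· < τ)).le_max' z (Finset.mem_filter.2 ⟨hz, h⟩)
      exact .inl ⟨h, by linarith⟩
    · have := (Z.filter (τ < ·)).min'_le z (Finset.mem_filter.2 ⟨hz, h⟩)
      exact .inr ⟨h, by linarith⟩

theorem exists_isIntegral_same_sign {F K : Type*} [Field F] [Field K] [LinearOrder K]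
    [IsStrictOrderedRing K] [IsRealClosed K] [Algebra F K] (P : Finset F[X])
    (hP : ∀ p ∈ P, p ≠ 0) {τ : K} (hτ : Transcendental F τ) :
    ∃ r : K, IsIntegral F r ∧ ∀ p ∈ P, 0 < aeval τ p * aeval r p := by
  classical
  obtain ⟨r, hr, hside⟩ := exists_isIntegral_same_side (F := F) (τ := τ)
    (P.biUnion fun p => (p.aroots K).toFinset) (fun z hz => by
      obtain ⟨p, hp, hz⟩ := Finset.mem_biUnion.1 hz
      rw [← isAlgebraic_iff_isIntegral]
      exact ⟨p, hP p hp, (mem_aroots.1 (Multiset.mem_toFinset.1 hz)).2⟩) (fun hz => by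
      obtain ⟨p, hp, hz⟩ := Finset.mem_biUnion.1 hz
      exact hτ ⟨p, hP p hp, (mem_aroots.1 (Multiset.mem_toFinset.1 hz)).2⟩)
  refine ⟨r, hr, fun p hp => ?_⟩
  have hroot : ∀ x, (p.map (algebraMap F K)).eval x = 0 → (x < τ ∧ x < r) ∨ (τ < x ∧ r < x) := by
    intro x hx
    refine hside x (Finset.mem_biUnion.2 ⟨p, hp, Multiset.mem_toFinset.2 (mem_aroots.2
      ⟨hP p hp, ?_⟩)⟩)
    rwa [eval_map_algebraMap] at hx
  rw [← eval_map_algebraMap, ← eval_map_algebraMap]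
  rcases le_total τ r with h | h
  · refine eval_mul_eval_pos h fun x hx h0 => ?_
    rcases hroot x h0 with h1 | h1
    · exact (h1.1.trans_le hx.1).false
    · exact (h1.2.trans_le hx.2).false
  · rw [mul_comm]
    refine eval_mul_eval_pos h fun x hx h0 => ?_
    rcases hroot x h0 with h1 | h1
    · exact (h1.2.trans_le hx.1).false
    · exact (h1.1.trans_le hx.2).false

variable {K : Type*} [Field K] [Algebra ℝ K] [LinearOrder K] [IsStrictOrderedRing K]
  [IsRealClosed K]

/-- Choose an algebraic `r` at which the numerators and denominators of `S` have the same signs as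
at `τ`. Rational functions with denominator nonzero at `r` embed in `K` by evaluation at `τ`;
evaluating them at `r` instead reduces to the algebraic case. -/
theorem HasSpecializations.adjoin_of_transcendental {F : IntermediateField ℝ K}
    (hF : HasSpecializations F) {τ : K} (hτ : Transcendental F τ) :
    HasSpecializations ((IntermediateField.adjoin F {τ}).restrictScalars ℝ) := by
  classical
  intro S hS
  have hfrac : ∀ c : K, ∃ p q : F[X], c ∈ S → aeval τ q ≠ 0 ∧ c * aeval τ q = aeval τ p := by
    intro c
    by_cases hc : c ∈ S
    · obtain ⟨p, q, rfl⟩ := (IntermediateField.mem_adjoin_simple_iff F c).1 (hS c hc)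
      -- Division by zero gives `0` here, which is rewritten as `0 / 1`.
      by_cases hq : aeval τ q = 0
      · exact ⟨0, 1, fun _ => by simp [hq]⟩
      · exact ⟨p, q, fun _ => ⟨hq, div_mul_cancel₀ _ hq⟩⟩
    · exact ⟨0, 0, fun h => absurd h hc⟩
  choose p q hpq using hfrac
  obtain ⟨r, hr, hsign⟩ := exists_isIntegral_same_sign
    ((S.image p ∪ S.image q).filter (· ≠ 0)) (fun p hp => (Finset.mem_filter.1 hp).2) hτ
  have hqr : ∀ c ∈ S, 0 < aeval τ (q c) * aeval r (q c) := fun c hc =>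
    hsign _ (Finset.mem_filter.2 ⟨Finset.mem_union_right _ (Finset.mem_image_of_mem _ hc),
      fun h0 => (hpq c hc).1 (by rw [h0, map_zero])⟩)
  have hpr : ∀ c ∈ S, c ≠ 0 → 0 < aeval τ (p c) * aeval r (p c) := fun c hc hc0 =>
    hsign _ (Finset.mem_filter.2 ⟨Finset.mem_union_left _ (Finset.mem_image_of_mem _ hc),
      fun h0 => by
        have h1 := (hpq c hc).2
        rw [h0, map_zero] at h1
        exact (mul_ne_zero hc0 (hpq c hc).1) h1⟩)
  have hqr0 : ∀ c ∈ S, aeval r (q c) ≠ 0 := fun c hc => right_ne_zero_of_mul (hqr c hc).ne'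
  have hint : ∀ x ∈ IntermediateField.adjoin F {r}, IsIntegral F x := fun x hx => by
    have : FiniteDimensional F (IntermediateField.adjoin F {r}) :=
      IntermediateField.adjoin.finiteDimensional hr
    exact (Algebra.IsIntegral.isIntegral (R := F)
      (⟨x, hx⟩ : IntermediateField.adjoin F {r})).map (IntermediateField.adjoin F {r}).val
  have hmem : ∀ f : F[X], aeval r f ∈ IntermediateField.adjoin F {r} := fun f =>
    IntermediateField.algebra_adjoin_le_adjoin F _ (aeval_mem_adjoin_singleton F r)
  obtain ⟨A, hA, ev, hev⟩ := hF.exists_algHom_of_isIntegral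
    (S.image fun c => aeval r (p c) / aeval r (q c)) (fun c hc => by
      obtain ⟨c, -, rfl⟩ := Finset.mem_image.1 hc
      exact hint _ (div_mem (hmem _) (hmem _)))
  let M : Submonoid F[X] := (nonZeroDivisors K).comap (aeval (R := F) r)
  have hM : ∀ f, f ∈ M ↔ aeval r f ≠ 0 := fun f => mem_nonZeroDivisors_iff_ne_zero
  have hτ0 : ∀ f : F[X], aeval τ f = 0 → f = 0 := fun f hf => by
    by_contra h0
    exact hτ ⟨f, h0, hf⟩
  -- `f` evaluates at `τ` and is injective by transcendence; `g` evaluates at `r`.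
  let f : Localization M →ₐ[ℝ] K := IsLocalization.liftAlgHom (M := M)
    (f := (aeval (R := F) τ).restrictScalars ℝ) fun y => IsUnit.mk0 _ fun h0 => by
      have := (hM y).1 y.2
      rw [hτ0 y h0, map_zero] at this
      exact this rfl
  let g : Localization M →ₐ[ℝ] K := IsLocalization.liftAlgHom (M := M)
    (f := (aeval (R := F) r).restrictScalars ℝ) fun y => IsUnit.mk0 _ ((hM y).1 y.2)
  have hf : ∀ x, f (algebraMap F[X] _ x) = aeval τ x := fun x => IsLocalization.lift_eq _ x
  have hg : ∀ x, g (algebraMap F[X] _ x) = aeval r x := fun x => IsLocalization.lift_eq _ x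
  have hinj : Function.Injective f := by
    rw [injective_iff_map_eq_zero]
    intro x hx
    obtain ⟨a, s, rfl⟩ := IsLocalization.exists_mk'_eq M x
    have h1 : f (IsLocalization.mk' (Localization M) a s * algebraMap F[X] _ s) = 0 := by
      rw [map_mul, hx, zero_mul]
    rw [IsLocalization.mk'_spec, hf] at h1
    rw [hτ0 a h1, IsLocalization.mk'_zero]
  have hlift : ∀ c ∈ S, ∃ x, f x = c ∧ g x = aeval r (p c) / aeval r (q c) := by
    intro c hc
    let x := IsLocalization.mk' (Localization M) (p c) ⟨q c, (hM _).2 (hqr0 c hc)⟩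
    have hx : x * algebraMap F[X] _ (q c) = algebraMap F[X] _ (p c) :=
      IsLocalization.mk'_spec _ _ _
    refine ⟨x, ?_, ?_⟩
    · have := congrArg f hx
      rw [map_mul, hf, hf, ← (hpq c hc).2] at this
      exact mul_right_cancel₀ (hpq c hc).1 this
    · have := congrArg g hx
      rw [map_mul, hg, hg] at this
      exact eq_div_of_mul_eq (hqr0 c hc) this
  let e := (A.comap g).equivMapOfInjective f hinj
  refine ⟨(A.comap g).map f, fun c hc => ?_,
    (ev.comp ((g.comp (A.comap g).val).codRestrict A fun x => x.2)).comp e.symm.toAlgHom,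
    fun c hc hpos => ?_⟩
  · obtain ⟨x, hx, hgx⟩ := hlift c hc
    refine ⟨x, ?_, hx⟩
    change g x ∈ A
    rw [hgx]
    exact hA _ (Finset.mem_image_of_mem _ hc)
  · obtain ⟨x, hx, hgx⟩ := hlift c hc
    have hxA : x ∈ A.comap g := by
      change g x ∈ A
      rw [hgx]
      exact hA _ (Finset.mem_image_of_mem _ hc)
    have he : ∀ h, e.symm ⟨c, h⟩ = ⟨x, hxA⟩ := by
      intro h
      rw [AlgEquiv.symm_apply_eq]
      exact Subtype.ext hx.symm
    have h1 : 0 < aeval r (p c) / aeval r (q c) := by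
      have h2 := hqr c hc
      have h3 := hpr c hc hpos.ne'
      rw [← (hpq c hc).2] at h3
      have h4 : 0 < (c * aeval τ (q c) * aeval r (p c)) * (aeval τ (q c) * aeval r (q c)) :=
        mul_pos h3 h2
      have h5 : 0 < c * (aeval τ (q c)) ^ 2 * (aeval r (q c)) ^ 2 := by
        have := (hpq c hc).1
        have := hqr0 c hc
        positivity
      have h6 : (c * aeval τ (q c) * aeval r (p c)) * (aeval τ (q c) * aeval r (q c)) =
          (aeval r (p c) / aeval r (q c)) * (c * (aeval τ (q c)) ^ 2 * (aeval r (q c)) ^ 2) := by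
        have := hqr0 c hc
        field_simp
      rw [h6] at h4
      exact (pos_iff_pos_of_mul_pos h4).2 h5
    have h2 := hev _ (Finset.mem_image_of_mem _ hc) h1
    convert h2 using 1
    change ev _ = ev _
    congr 1
    apply Subtype.ext
    change g (e.symm ⟨c, _⟩ : Localization M) = _
    rw [he]
    exact hgx

theorem hasSpecializations_adjoin (S : Finset K) :
    HasSpecializations (IntermediateField.adjoin ℝ (S : Set K)) := by
  refine IntermediateField.induction_on_adjoin_finset S HasSpecializations hasSpecializations_bot
    fun F x _ hF => ?_
  by_cases hx : IsAlgebraic F x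
  · intro T hT
    refine hF.exists_algHom_of_isIntegral T fun c hc => ?_
    have : FiniteDimensional F (IntermediateField.adjoin F {x}) :=
      IntermediateField.adjoin.finiteDimensional hx.isIntegral
    exact (Algebra.IsIntegral.isIntegral (R := F)
      (⟨c, hT c hc⟩ : IntermediateField.adjoin F {x})).map (IntermediateField.adjoin F {x}).val
  · exact hF.adjoin_of_transcendental hx

/-- Artin–Lang: finitely many elements of a real closed extension of `ℝ` can be specialized to real
numbers. -/
theorem exists_specialization (S : Finset K) :
    ∃ A : Subalgebra ℝ K, (∀ c ∈ S, c ∈ A) ∧ Nonempty (A →ₐ[ℝ] ℝ) := by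
  obtain ⟨A, hA, ev, -⟩ := hasSpecializations_adjoin S S fun c hc =>
    IntermediateField.subset_adjoin ℝ _ hc
  exact ⟨A, hA, ⟨ev⟩⟩

end RealClosure

/-! ### The real Nullstellensatz and functionals nonnegative on squares. -/

section Nullstellensatz

open RealClosure

theorem Ideal.exists_maximal_disjoint {A : Type*} [CommRing A] (I : Ideal A) (S : Set A)
    (h : Disjoint (I : Set A) S) :
    ∃ J : Ideal A, I ≤ J ∧ Disjoint (J : Set A) S ∧ ∀ J', J < J' → ¬ Disjoint (J' : Set A) S := by
  obtain ⟨J, hIJ, hJ⟩ := zorn_le_nonempty₀ {J : Ideal A | Disjoint (J : Set A) S}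
    (fun c hc hchain J₀ hJ₀ => ⟨sSup c, by
      rw [Set.mem_ofPred_eq, Set.disjoint_left]
      intro x hx hxS
      obtain ⟨J, hJ, hxJ⟩ := (Submodule.mem_sSup_of_directed ⟨J₀, hJ₀⟩ hchain.directedOn).1 hx
      exact Set.disjoint_left.1 (hc hJ) hxJ hxS, fun J hJ => le_sSup hJ⟩) I h
  exact ⟨J, hIJ, hJ.1, fun J' hJ' hd => hJ'.not_ge (hJ.2 hd hJ'.le)⟩

/-- Take an ideal containing `I`, maximal among those disjoint from the monoid of all `f ^ (2k) +
s`. If `a ∉ p`, some `f ^ (2k) + t` equals `u + w * a` with `u ∈ p`. If also `a ^ 2 + s ∈ p`,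
squaring and adding `w ^ 2 * s` puts a monoid element in `p`. -/
theorem exists_real_prime {A : Type*} [CommRing A] (I : Ideal A) (f : A)
    (h : ∀ (k : ℕ) (s : A), IsSumSq s → f ^ (2 * k) + s ∉ I) :
    ∃ p : Ideal A, p.IsPrime ∧ I ≤ p ∧ f ∉ p ∧ ∀ a s, IsSumSq s → a ^ 2 + s ∈ p → a ∈ p := by
  have hsq : ∀ x : A, IsSumSq (x ^ 2) := fun x => by rw [sq]; exact .mul_self x
  have hpow : ∀ k, IsSumSq (f ^ (2 * k)) := fun k => by rw [mul_comm, pow_mul]; exact hsq _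
  let S : Submonoid A :=
    { carrier := {x | ∃ (k : ℕ) (s : A), IsSumSq s ∧ x = f ^ (2 * k) + s}
      one_mem' := ⟨0, 0, .zero, by simp⟩
      mul_mem' := by
        rintro _ _ ⟨k, s, hs, rfl⟩ ⟨l, t, ht, rfl⟩
        refine ⟨k + l, f ^ (2 * k) * t + s * f ^ (2 * l) + s * t,
          (((hpow k).mul ht).add (hs.mul (hpow l))).add (hs.mul ht), by ring⟩ }
  obtain ⟨p, hIp, hdisj, hmax⟩ := I.exists_maximal_disjoint (S : Set A) (by
    rw [Set.disjoint_left]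
    rintro x hx ⟨k, s, hs, rfl⟩
    exact h k s hs hx)
  have hpS : ∀ k s, IsSumSq s → f ^ (2 * k) + s ∉ p := fun k s hs hp =>
    Set.disjoint_left.1 hdisj hp ⟨k, s, hs, rfl⟩
  refine ⟨p, p.isPrime_of_maximally_disjoint S hdisj hmax, hIp, fun hf => ?_,
    fun a s hs has => ?_⟩
  · refine hpS 1 0 .zero ?_
    rw [add_zero, mul_one, sq]
    exact p.mul_mem_left _ hf
  · by_contra ha
    have hlt : p < p ⊔ Ideal.span {a} := by
      refine lt_of_le_of_ne le_sup_left fun he => ha ?_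
      rw [he]
      exact Ideal.mem_sup_right (Ideal.mem_span_singleton_self a)
    obtain ⟨x, hx, k, t, ht, rfl⟩ := Set.not_disjoint_iff.1 (hmax _ hlt)
    obtain ⟨u, hu, v, hv, huv⟩ := Submodule.mem_sup.1 hx
    obtain ⟨w, rfl⟩ := Ideal.mem_span_singleton'.1 hv
    refine hpS (k + k) (f ^ (2 * k) * t + t * f ^ (2 * k) + t * t + w ^ 2 * s)
      (((((hpow k).mul ht).add (ht.mul (hpow k))).add (ht.mul ht)).add ((hsq w).mul hs)) ?_
    have h1 : f ^ (2 * (k + k)) + (f ^ (2 * k) * t + t * f ^ (2 * k) + t * t + w ^ 2 * s) =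
        u * (u + 2 * (w * a)) + w ^ 2 * (a ^ 2 + s) := by
      have : f ^ (2 * (k + k)) = f ^ (2 * k) * f ^ (2 * k) := by ring
      rw [this]
      linear_combination -(u + w * a + (f ^ (2 * k) + t)) * huv
    rw [h1]
    exact p.add_mem (p.mul_mem_right _ hu) (p.mul_mem_left _ has)

/-- Clearing denominators in `1 + s = 0` gives `d ^ 2 + t ∈ p` with `d ∉ p`, against the reality of
`p`. -/
theorem isSemireal_fractionRing {A K : Type*} [CommRing A] [Field K] (p : Ideal A) [p.IsPrime]
    (hp : ∀ a s, IsSumSq s → a ^ 2 + s ∈ p → a ∈ p) [Algebra (A ⧸ p) K] [IsFractionRing (A ⧸ p) K] :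
    IsSemireal K := by
  let φ : A →+* K := (algebraMap (A ⧸ p) K).comp (Ideal.Quotient.mk p)
  have hφ : ∀ a, φ a = 0 ↔ a ∈ p := fun a => by
    rw [← Ideal.Quotient.eq_zero_iff_mem]
    exact map_eq_zero_iff _ (IsFractionRing.injective (A ⧸ p) K)
  have hsum : ∀ s : K, IsSumSq s → ∃ d ∉ p, ∃ t, IsSumSq t ∧ s * φ d ^ 2 = φ t := by
    intro s hs
    induction hs with
    | zero => exact ⟨1, (Ideal.ne_top_iff_one p).1 (Ideal.IsPrime.ne_top ‹_›), 0, .zero, by simp⟩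
    | sq_add x _ ih =>
      obtain ⟨d, hd, t, ht, hst⟩ := ih
      obtain ⟨a, b, hb, rfl⟩ := IsFractionRing.div_surjective (A := A ⧸ p) x
      obtain ⟨a, rfl⟩ := Ideal.Quotient.mk_surjective a
      obtain ⟨b, rfl⟩ := Ideal.Quotient.mk_surjective b
      have hb' : b ∉ p := by
        rw [← Ideal.Quotient.eq_zero_iff_mem]
        exact nonZeroDivisors.ne_zero hb
      have hb0 : φ b ≠ 0 := mt (hφ b).1 hb'
      refine ⟨b * d, fun h => (Ideal.IsPrime.mem_or_mem ‹_› h).elim hb' hd,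
        (a * d) * (a * d) + b * b * t, .sq_add _ ((IsSumSq.mul_self b).mul ht), ?_⟩
      change (φ a / φ b * (φ a / φ b) + _) * _ = _
      simp only [map_mul, map_add, ← hst]
      field_simp
  refine ⟨fun {s} hs h0 => ?_⟩
  obtain ⟨d, hd, t, ht, hst⟩ := hsum s hs
  refine hd (hp d t ht ((hφ _).1 ?_))
  rw [map_add, map_pow, ← hst]
  linear_combination φ d ^ 2 * h0

/-- The real Nullstellensatz. -/
theorem exists_character_ne_zero {A : Type*} [CommRing A] [Algebra ℝ A] [Algebra.FiniteType ℝ A]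
    (I : Ideal A) (f : A) (h : ∀ (k : ℕ) (s : A), IsSumSq s → f ^ (2 * k) + s ∉ I) :
    ∃ χ : A →ₐ[ℝ] ℝ, (∀ g ∈ I, χ g = 0) ∧ χ f ≠ 0 := by
  classical
  obtain ⟨p, hprime, hIp, hf, hreal⟩ := exists_real_prime I f h
  have hsr : IsSemireal (FractionRing (A ⧸ p)) := isSemireal_fractionRing p hreal
  obtain ⟨E, hrc, ho, hos⟩ := exists_realClosed_extension (FractionRing (A ⧸ p))
  let ψ : A →+* E := ((algebraMap (FractionRing (A ⧸ p)) E).comp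
    (algebraMap (A ⧸ p) (FractionRing (A ⧸ p)))).comp (Ideal.Quotient.mk p)
  have hψ : ∀ a, ψ a = 0 ↔ a ∈ p := fun a => by
    rw [← Ideal.Quotient.eq_zero_iff_mem]
    exact (map_eq_zero (algebraMap (FractionRing (A ⧸ p)) E)).trans
      (map_eq_zero_iff _ (IsFractionRing.injective (A ⧸ p) (FractionRing (A ⧸ p))))
  let _ : Algebra ℝ E := (ψ.comp (algebraMap ℝ A)).toAlgebra
  let φ : A →ₐ[ℝ] E := { ψ with commutes' := fun r => rfl }
  obtain ⟨G, hG⟩ := (Algebra.FiniteType.out : (⊤ : Subalgebra ℝ A).FG)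
  -- Specializing the inverse of `φ f` as well ensures that the value of `f` is not zero.
  obtain ⟨O, hO, ⟨ev⟩⟩ := exists_specialization (K := E) (insert (φ f)⁻¹ (G.image φ))
  have hφO : ∀ a, φ a ∈ O := by
    have : (⊤ : Subalgebra ℝ A) ≤ O.comap φ := by
      rw [← hG, Algebra.adjoin_le_iff]
      exact fun g hg => hO _ (Finset.mem_insert_of_mem (Finset.mem_image_of_mem _ hg))
    exact fun a => this Algebra.mem_top
  have hinv : (φ f)⁻¹ ∈ O := hO _ (Finset.mem_insert_self _ _)
  refine ⟨ev.comp (φ.codRestrict O hφO), fun g hg => ?_, ?_⟩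
  · have h1 : φ.codRestrict O hφO g = 0 := Subtype.ext ((hψ g).2 (hIp hg))
    rw [AlgHom.comp_apply, h1, map_zero]
  · have h1 : φ.codRestrict O hφO f * ⟨_, hinv⟩ = 1 :=
      Subtype.ext (mul_inv_cancel₀ fun h0 => hf ((hψ f).1 h0))
    have h2 := congrArg ev h1
    rw [map_mul, map_one] at h2
    exact left_ne_zero_of_mul_eq_one h2

/-- The degenerate case of Cauchy–Schwarz: `t ↦ L ((h + t • g) ^ 2)` is affine and nonnegative,
hence constant. -/
theorem LinearMap.map_mul_eq_zero_of_map_sq_eq_zero {A : Type*} [CommRing A] [Algebra ℝ A]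
    (L : A →ₗ[ℝ] ℝ) (hL : ∀ a, 0 ≤ L (a ^ 2)) {g : A} (hg : L (g ^ 2) = 0) (h : A) :
    L (g * h) = 0 := by
  by_contra hne
  have key : ∀ t : ℝ, 0 ≤ L (h ^ 2) + 2 * t * L (g * h) := by
    intro t
    have h1 := hL (h + t • g)
    have h2 : (h + t • g) ^ 2 = h ^ 2 + (2 * t) • (g * h) + (t ^ 2) • g ^ 2 := by
      simp only [Algebra.smul_def, map_mul, map_pow, map_ofNat]
      ring
    rw [h2, map_add, map_add, map_smul, map_smul, hg, smul_eq_mul, smul_zero, add_zero] at h1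
    exact h1
  -- At this `t` the affine function takes the value `-1`.
  have h1 := key (-(L (h ^ 2) + 1) / (2 * L (g * h)))
  have h2 : 2 * (-(L (h ^ 2) + 1) / (2 * L (g * h))) * L (g * h) = -(L (h ^ 2) + 1) := by
    field_simp
  rw [h2] at h1
  linarith

theorem LinearMap.map_eq_zero_of_map_pow_eq_zero {A : Type*} [CommRing A] [Algebra ℝ A]
    (L : A →ₗ[ℝ] ℝ) (hL : ∀ a, 0 ≤ L (a ^ 2)) (f : A) (k : ℕ) (hk : L (f ^ (2 * k)) = 0) :
    L f = 0 := by
  induction k with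
  | zero =>
    have := L.map_mul_eq_zero_of_map_sq_eq_zero hL (g := 1) (by simpa using hk) f
    simpa using this
  | succ k ih =>
    have h1 := L.map_mul_eq_zero_of_map_sq_eq_zero hL (g := f ^ (k + 1))
      (by rw [← pow_mul, mul_comm]; exact hk)
    rcases k with _ | k
    · simpa using h1 1
    -- Pairing `f ^ (k + 2)` with `f ^ k` gives exponent `2 * (k + 1)`.
    · refine ih ?_
      have := h1 (f ^ k)
      rw [← pow_add] at this
      convert this using 2
      congr 1
      omega

/-- A functional that is nonnegative on squares and vanishes on an ideal vanishes on all elements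
that are zero at every character annihilating the ideal. -/
theorem LinearMap.eq_zero_of_forall_character {A : Type*} [CommRing A] [Algebra ℝ A]
    [Algebra.FiniteType ℝ A] (L : A →ₗ[ℝ] ℝ) (hL : ∀ a, 0 ≤ L (a ^ 2)) (I : Ideal A)
    (hI : ∀ g ∈ I, L g = 0) {f : A} (hf : ∀ χ : A →ₐ[ℝ] ℝ, (∀ g ∈ I, χ g = 0) → χ f = 0) :
    L f = 0 := by
  have hsum : ∀ s, IsSumSq s → 0 ≤ L s := by
    intro s hs
    induction hs with
    | zero => simp
    | sq_add a _ ih =>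
      rw [map_add, ← sq]
      exact add_nonneg (hL a) ih
  by_contra hne
  obtain ⟨χ, hχ, hχf⟩ := exists_character_ne_zero I f fun k s hs hmem => by
    refine hne (L.map_eq_zero_of_map_pow_eq_zero hL f k ?_)
    have h1 := hI _ hmem
    rw [map_add] at h1
    have h2 := hL (f ^ k)
    rw [← pow_mul, mul_comm] at h2
    linarith [hsum s hs]
  exact hχf (hf χ hχ)

end Nullstellensatz

/-! ### Topology of the character space and transfer of measures to a quotient. -/

namespace MomentProblem

section Topology

variable {A : Type*} [CommRing A] [Algebra ℝ A]

theorem continuous_eval (f : A) : Continuous fun χ : A →ₐ[ℝ] ℝ => χ f :=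
  (continuous_apply f).comp continuous_induced_dom

theorem le_characterTopology {t : TopologicalSpace (A →ₐ[ℝ] ℝ)}
    (h : ∀ f : A, @Continuous _ _ t _ fun χ : A →ₐ[ℝ] ℝ => χ f) : t ≤ characterTopology := by
  rw [characterTopology, induced_to_pi]
  exact le_iInf fun f => continuous_iff_le_induced.1 (h f)

/-- Evaluation at finitely many generators already induces the topology, so the characters embed in
a finite power of `ℝ`. -/
instance secondCountableTopology_character [Algebra.FiniteType ℝ A] :
    SecondCountableTopology (A →ₐ[ℝ] ℝ) := by
  obtain ⟨G, hG⟩ := (Algebra.FiniteType.out : (⊤ : Subalgebra ℝ A).FG)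
  have hind : Topology.IsInducing fun (χ : A →ₐ[ℝ] ℝ) (g : G) => χ g := by
    refine ⟨le_antisymm (continuous_pi fun g : G => continuous_eval (g : A)).le_induced ?_⟩
    have hcont : ∀ a : A, @Continuous _ _ (TopologicalSpace.induced
        (fun (χ : A →ₐ[ℝ] ℝ) (g : G) => χ g) inferInstance) _ fun χ : A →ₐ[ℝ] ℝ => χ a := by
      intro a
      have ha : a ∈ Algebra.adjoin ℝ (G : Set A) := hG ▸ Algebra.mem_top
      let _ : TopologicalSpace (A →ₐ[ℝ] ℝ) := TopologicalSpace.induced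
        (fun (χ : A →ₐ[ℝ] ℝ) (g : G) => χ g) inferInstance
      induction ha using Algebra.adjoin_induction with
      | mem x hx =>
        have h : Continuous fun (χ : A →ₐ[ℝ] ℝ) (g : G) => χ g := continuous_induced_dom
        exact continuous_pi_iff.1 h ⟨x, hx⟩
      | algebraMap r => simpa using continuous_const
      | add x y _ _ hx hy => simp only [map_add]; exact hx.add hy
      | mul x y _ _ hx hy => simp only [map_mul]; exact hx.mul hy
    exact le_characterTopology hcont
  exact hind.secondCountableTopology

theorem isClosed_zeroSet (I : Ideal A) : IsClosed (zeroSet I) := by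
  have : zeroSet I = ⋂ f ∈ I, {χ : A →ₐ[ℝ] ℝ | χ f = 0} := by
    ext χ; simp [zeroSet]
  rw [this]
  exact isClosed_biInter fun f _ => isClosed_eq (continuous_eval f) continuous_const

theorem Preord.isClosed_charSet (T : Preord A) : IsClosed T.charSet := by
  have : T.charSet = ⋂ f ∈ T.carrier, {χ : A →ₐ[ℝ] ℝ | 0 ≤ χ f} := by
    ext χ; simp [Preord.charSet]
  rw [this]
  exact isClosed_biInter fun f _ => isClosed_le continuous_const (continuous_eval f)

/-- Since `f ^ 2 ∈ I`, its integral is zero, so `f` vanishes almost everywhere, and its zero locus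
is closed. -/
theorem Represents.support_subset_zeroSet {μ : Measure (A →ₐ[ℝ] ℝ)} {L : A →ₗ[ℝ] ℝ}
    (h : Represents μ L) (I : Ideal A) (hI : ∀ f ∈ I, L f = 0) : μ.support ⊆ zeroSet I := by
  intro χ hχ f hf
  refine Measure.support_subset_of_isClosed (t := {χ : A →ₐ[ℝ] ℝ | χ f = 0})
    (isClosed_eq (continuous_eval f) continuous_const) ?_ hχ
  obtain ⟨hint, heq⟩ := h (f ^ 2)
  rw [hI _ (Ideal.pow_mem_of_mem I hf 2 two_pos)] at heq
  have h0 := (integral_eq_zero_iff_of_nonneg (fun χ => by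
    simp only [map_pow]; exact sq_nonneg _) hint).1 heq.symm
  filter_upwards [h0] with χ hχ
  simpa using hχ

/-- The embedding of the characters of `A ⧸ I` in the characters of `A`. -/
def quotientCharacter (I : Ideal A) (χ : A ⧸ I →ₐ[ℝ] ℝ) : A →ₐ[ℝ] ℝ :=
  χ.comp (Ideal.Quotient.mkₐ ℝ I)

theorem quotientCharacter_apply (I : Ideal A) (χ : A ⧸ I →ₐ[ℝ] ℝ) (f : A) :
    quotientCharacter I χ f = χ (Ideal.Quotient.mk I f) := rfl

theorem range_quotientCharacter (I : Ideal A) : Set.range (quotientCharacter I) = zeroSet I := by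
  ext χ
  constructor
  · rintro ⟨χ, rfl⟩ f hf
    rw [quotientCharacter_apply, Ideal.Quotient.eq_zero_iff_mem.2 hf, map_zero]
  · intro hχ
    exact ⟨Ideal.Quotient.liftₐ I χ hχ, AlgHom.ext fun f => rfl⟩

theorem isClosedEmbedding_quotientCharacter (I : Ideal A) :
    Topology.IsClosedEmbedding (quotientCharacter I) where
  eq_induced := by
    have hcont : Continuous (quotientCharacter I) :=
      continuous_induced_rng.2 (continuous_pi fun f => continuous_eval (Ideal.Quotient.mk I f))
    refine le_antisymm hcont.le_induced ?_
    refine le_characterTopology fun q => ?_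
    obtain ⟨f, rfl⟩ := Ideal.Quotient.mk_surjective q
    have h : @Continuous _ _ (TopologicalSpace.induced (quotientCharacter I) characterTopology) _
      (quotientCharacter I) := continuous_induced_dom
    exact @Continuous.comp _ _ _ (_) _ _ _ _ (continuous_eval f) h
  injective := fun χ₁ χ₂ h => AlgHom.ext fun q => by
    obtain ⟨f, rfl⟩ := Ideal.Quotient.mk_surjective q
    exact DFunLike.congr_fun h f
  isClosed_range := by rw [range_quotientCharacter]; exact isClosed_zeroSet I

theorem measurableEmbedding_quotientCharacter (I : Ideal A) :
    MeasurableEmbedding (quotientCharacter I) :=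
  (isClosedEmbedding_quotientCharacter I).measurableEmbedding

theorem represents_map_quotientCharacter (I : Ideal A) {ν : Measure (A ⧸ I →ₐ[ℝ] ℝ)}
    {L : A →ₗ[ℝ] ℝ} {L' : A ⧸ I →ₗ[ℝ] ℝ} (hL : ∀ f, L f = L' (Ideal.Quotient.mk I f)) :
    Represents (ν.map (quotientCharacter I)) L ↔ Represents ν L' := by
  have he := measurableEmbedding_quotientCharacter I
  have key : ∀ f, (Integrable (fun χ : A →ₐ[ℝ] ℝ => χ f) (ν.map (quotientCharacter I)) ∧
      L f = ∫ χ : A →ₐ[ℝ] ℝ, χ f ∂(ν.map (quotientCharacter I))) ↔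
      (Integrable (fun χ : A ⧸ I →ₐ[ℝ] ℝ => χ (Ideal.Quotient.mk I f)) ν ∧
      L' (Ideal.Quotient.mk I f) = ∫ χ : A ⧸ I →ₐ[ℝ] ℝ, χ (Ideal.Quotient.mk I f) ∂ν) := by
    intro f
    rw [he.integrable_map_iff, he.integral_map, hL]
    rfl
  constructor
  · intro h q
    obtain ⟨f, rfl⟩ := Ideal.Quotient.mk_surjective q
    exact (key f).1 (h f)
  · exact fun h f => (key f).2 (h _)

/-- By second countability `μ` is concentrated on its support, which lies in the range `Z(I)` of the
embedding. -/
theorem Represents.map_comap_quotientCharacter [Algebra.FiniteType ℝ A] (I : Ideal A)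
    {μ : Measure (A →ₐ[ℝ] ℝ)} {L : A →ₗ[ℝ] ℝ} (h : Represents μ L) (hI : ∀ f ∈ I, L f = 0) :
    (μ.comap (quotientCharacter I)).map (quotientCharacter I) = μ := by
  rw [(measurableEmbedding_quotientCharacter I).map_comap, range_quotientCharacter]
  exact Measure.restrict_eq_self_of_ae_mem
    (Filter.mem_of_superset Measure.support_mem_ae (h.support_subset_zeroSet I hI))

end Topology

/-! ### Positive functionals and the three assertions. -/

namespace Preord

theorem zero_mem {A : Type*} [CommRing A] (T : Preord A) : (0 : A) ∈ T.carrier := by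
  simpa using T.sq_mul_mem 0 1 T.one_mem

theorem sq_mem {A : Type*} [CommRing A] (T : Preord A) (a : A) : a ^ 2 ∈ T.carrier := by
  simpa using T.sq_mul_mem a 1 T.one_mem

theorem subset_addIdeal {A : Type*} [CommRing A] (T : Preord A) (I : Ideal A) :
    T.carrier ⊆ (T.addIdeal I).carrier := fun t ht => ⟨t, ht, 0, I.zero_mem, add_zero t⟩

theorem mem_addIdeal_of_mem {A : Type*} [CommRing A] (T : Preord A) {I : Ideal A} {a : A}
    (ha : a ∈ I) : a ∈ (T.addIdeal I).carrier := ⟨0, T.zero_mem, a, ha, zero_add a⟩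

theorem addIdeal_mono {A : Type*} [CommRing A] (T : Preord A) {I J : Ideal A} (h : I ≤ J) :
    (T.addIdeal I).carrier ⊆ (T.addIdeal J).carrier := by
  rintro _ ⟨t, ht, i, hi, rfl⟩
  exact ⟨t, ht, i, h hi, rfl⟩

variable {A : Type*} [CommRing A] [Algebra ℝ A] {T : Preord A} {I : Ideal A}

theorem PositiveOn.eq_zero {L : A →ₗ[ℝ] ℝ} (hL : (T.addIdeal I).PositiveOn L) {f : A}
    (hf : f ∈ I) : L f = 0 := by
  have h1 := hL f (T.mem_addIdeal_of_mem hf)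
  have h2 := hL (-f) (T.mem_addIdeal_of_mem (I.neg_mem hf))
  rw [map_neg] at h2
  linarith

theorem PositiveOn.of_addIdeal {L : A →ₗ[ℝ] ℝ} (hL : (T.addIdeal I).PositiveOn L) :
    T.PositiveOn L := fun f hf => hL f (T.subset_addIdeal I hf)

theorem charSet_addIdeal : (T.addIdeal I).charSet = T.charSet ∩ zeroSet I := by
  ext χ
  constructor
  · intro hχ
    refine ⟨fun f hf => hχ f (T.subset_addIdeal I hf), fun f hf => ?_⟩
    exact PositiveOn.eq_zero (L := χ.toLinearMap) hχ hf
  · rintro ⟨h1, h2⟩ _ ⟨t, ht, i, hi, rfl⟩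
    rw [map_add, h2 i hi, add_zero]
    exact h1 t ht

theorem mem_charSet_quotient {χ : A ⧸ I →ₐ[ℝ] ℝ} :
    χ ∈ (T.quotient I).charSet ↔ quotientCharacter I χ ∈ T.charSet :=
  ⟨fun h f hf => h _ ⟨f, hf, rfl⟩, by rintro h _ ⟨f, hf, rfl⟩; exact h f hf⟩

theorem SMP.addIdeal (h : T.SMP) : (T.addIdeal I).SMP := by
  intro L hL
  obtain ⟨μ, hμ, hrep⟩ := h L hL.of_addIdeal
  refine ⟨μ, ?_, hrep⟩
  rw [charSet_addIdeal]
  exact Set.subset_inter hμ (hrep.support_subset_zeroSet I fun f => hL.eq_zero)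

theorem MP.addIdeal (h : T.MP) : (T.addIdeal I).MP := fun L hL => h L hL.of_addIdeal

theorem PositiveOn.exists_quotient {L : A →ₗ[ℝ] ℝ} (hL : (T.addIdeal I).PositiveOn L) :
    ∃ L' : A ⧸ I →ₗ[ℝ] ℝ, ((T.addIdeal I).quotient I).PositiveOn L' ∧
      ∀ f, L f = L' (Ideal.Quotient.mk I f) := by
  obtain ⟨s, hs⟩ := (Ideal.Quotient.mkₐ ℝ I).toLinearMap.exists_rightInverse_of_surjective
    (LinearMap.range_eq_top.2 (Ideal.Quotient.mkₐ_surjective ℝ I))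
  have hLs : ∀ f, L f = (L ∘ₗ s) (Ideal.Quotient.mk I f) := by
    intro f
    rw [LinearMap.comp_apply, ← sub_eq_zero, ← map_sub]
    refine hL.eq_zero ?_
    rw [← Ideal.Quotient.eq]
    exact (DFunLike.congr_fun hs (Ideal.Quotient.mk I f)).symm
  refine ⟨L ∘ₗ s, ?_, hLs⟩
  rintro _ ⟨f, hf, rfl⟩
  rw [← hLs]
  exact hL f hf

theorem PositiveOn.comp_mk {L : A ⧸ I →ₗ[ℝ] ℝ} (hL : ((T.addIdeal I).quotient I).PositiveOn L) :
    (T.addIdeal I).PositiveOn (L ∘ₗ (Ideal.Quotient.mkₐ ℝ I).toLinearMap) :=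
  fun f hf => hL _ ⟨f, hf, rfl⟩

theorem charSet_addIdeal_hatIdeal :
    (T.addIdeal (hatIdeal I)).charSet = (T.addIdeal I).charSet := by
  rw [charSet_addIdeal, charSet_addIdeal]
  congr 1
  exact Set.Subset.antisymm (fun χ hχ f hf => hχ f fun ψ hψ => hψ f hf) fun χ hχ f hf => hf χ hχ

variable [Algebra.FiniteType ℝ A]

theorem smp_addIdeal_iff_quotient : (T.addIdeal I).SMP ↔ ((T.addIdeal I).quotient I).SMP := by
  constructor
  · intro h L hL
    obtain ⟨μ, hμ, hrep⟩ := h _ hL.comp_mk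
    have hmap := hrep.map_comap_quotientCharacter I fun f => hL.comp_mk.eq_zero
    refine ⟨μ.comap (quotientCharacter I), ?_,
      (represents_map_quotientCharacter I fun f => rfl).1 (hmap.symm ▸ hrep)⟩
    -- As `K(T)` is closed, the support condition amounts to membership almost everywhere, which
    -- transfers along the embedding.
    refine Measure.support_subset_of_isClosed (isClosed_charSet _) ?_
    have hae : ∀ᵐ χ ∂((μ.comap (quotientCharacter I)).map (quotientCharacter I)),
        χ ∈ (T.addIdeal I).charSet := by
      rw [hmap]
      exact Filter.mem_of_superset Measure.support_mem_ae hμ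
    rw [(measurableEmbedding_quotientCharacter I).ae_map_iff] at hae
    filter_upwards [hae] with χ hχ
    exact mem_charSet_quotient.2 hχ
  · intro h L hL
    obtain ⟨L', hL', hLL'⟩ := hL.exists_quotient
    obtain ⟨ν, hν, hrep⟩ := h L' hL'
    have : Algebra.FiniteType ℝ (A ⧸ I) :=
      Algebra.FiniteType.of_surjective (Ideal.Quotient.mkₐ ℝ I) (Ideal.Quotient.mkₐ_surjective ℝ I)
    refine ⟨ν.map (quotientCharacter I), ?_, (represents_map_quotientCharacter I hLL').2 hrep⟩
    refine Measure.support_subset_of_isClosed (isClosed_charSet _) ?_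
    change ∀ᵐ χ ∂_, χ ∈ (T.addIdeal I).charSet
    rw [(measurableEmbedding_quotientCharacter I).ae_map_iff]
    filter_upwards [Measure.support_mem_ae (μ := ν)] with χ hχ
    exact mem_charSet_quotient.1 (hν hχ)

theorem mp_addIdeal_iff_quotient : (T.addIdeal I).MP ↔ ((T.addIdeal I).quotient I).MP := by
  constructor
  · intro h L hL
    obtain ⟨μ, hrep⟩ := h _ hL.comp_mk
    have hmap := hrep.map_comap_quotientCharacter I fun f => hL.comp_mk.eq_zero
    exact ⟨μ.comap (quotientCharacter I),
      (represents_map_quotientCharacter I fun f => rfl).1 (hmap.symm ▸ hrep)⟩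
  · intro h L hL
    obtain ⟨L', hL', hLL'⟩ := hL.exists_quotient
    obtain ⟨ν, hrep⟩ := h L' hL'
    exact ⟨ν.map (quotientCharacter I), (represents_map_quotientCharacter I hLL').2 hrep⟩

/-- The heart of (iii): by the Nullstellensatz a `T + I`-positive functional also vanishes on `Î`.
-/
theorem positiveOn_addIdeal_hatIdeal {L : A →ₗ[ℝ] ℝ} :
    (T.addIdeal (hatIdeal I)).PositiveOn L ↔ (T.addIdeal I).PositiveOn L := by
  constructor
  · exact fun h f hf => h f (T.addIdeal_mono (J := hatIdeal I) (fun g hg χ hχ => hχ g hg) hf)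
  · rintro h _ ⟨t, ht, i, hi, rfl⟩
    rw [map_add, L.eq_zero_of_forall_character (fun a => h.of_addIdeal _ (T.sq_mem a)) I
      (fun g => h.eq_zero) hi, add_zero]
    exact h.of_addIdeal t ht

end Preord

end MomentProblem

theorem mainTheorem6 {A : Type*} [CommRing A] [Algebra ℝ A] [Algebra.FiniteType ℝ A]
    (I : Ideal A) (T : MomentProblem.Preord A) (hT : T.FinitelyGenerated) :
    ((T.SMP → (T.addIdeal I).SMP) ∧ (T.MP → (T.addIdeal I).MP)) ∧
    (((T.addIdeal I).SMP ↔ ((T.addIdeal I).quotient I).SMP) ∧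
      ((T.addIdeal I).MP ↔ ((T.addIdeal I).quotient I).MP)) ∧
    (((T.addIdeal I).SMP ↔ (T.addIdeal (MomentProblem.hatIdeal I)).SMP) ∧
      ((T.addIdeal I).MP ↔ (T.addIdeal (MomentProblem.hatIdeal I)).MP)) := by
  refine ⟨⟨.addIdeal, .addIdeal⟩, ⟨MomentProblem.Preord.smp_addIdeal_iff_quotient,
    MomentProblem.Preord.mp_addIdeal_iff_quotient⟩, ?_, ?_⟩
  · simp only [MomentProblem.Preord.SMP, MomentProblem.Preord.positiveOn_addIdeal_hatIdeal,
      MomentProblem.Preord.charSet_addIdeal_hatIdeal]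
  · simp only [MomentProblem.Preord.MP, MomentProblem.Preord.positiveOn_addIdeal_hatIdeal]
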